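/- Let $m,p\ge 1$ be integers, let $\mathsf H_1,\dots,\mathsf H_m$ and $\mathsf G_1,\dots,\mathsf G_p$ be separable real Hilbert spaces, and let $\boldsymbol{\mathsf H}=\mathsf H_1\oplus\cdots\oplus\mathsf H_m$ be the direct Hilbert sum, with generic element $\boldsymbol{\mathsf x}=(\mathsf x_1,\dots,\mathsf x_m)$. Set $\mathsf D=\{0,1\}^m\smallsetminus\{\boldsymbol 0\}$. For a real Hilbert space $\mathsf H$, $\Gamma_0(\mathsf H)$ denotes the class of lower semicontinuous convex functions $\mathsf f\colon\mathsf H\to\,]-\infty,+\infty]$ with $\mathsf f\not\equiv+\infty$ and, for $\mathsf f\in\Gamma_0(\mathsf H)$, $\mathrm{prox}_{\mathsf f}\,\mathsf x$ denotes the unique minimizer of $\mathsf y\mapsto\mathsf f(\mathsf y)+\|\mathsf x-\mathsf y\|^2/2$. For every $i\in\{1,\dots,m\}$ let $\mathsf f_i\in\Gamma_0(\mathsf H_i)$ and, for every $k\in\{1,\dots,p\}$, let $\tau_k\in\,]0,+\infty[$, let $\mathsf g_k\colon\mathsf G_k\to\mathbb R$ be a differentiable convex function with a $\tau_k$-Lipschitz-continuous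 gradient, and let $\mathsf L_{ki}\colon\mathsf H_i\to\mathsf G_k$ be linear and bounded. Assume that $\min_{1\le k\le p}\sum_{i=1}^m\|\mathsf L_{ki}\|^2>0$ and that the set $\boldsymbol{\mathsf F}$ of solutions to the problem $$\underset{\mathsf x_1\in\mathsf H_1,\dots,\mathsf x_m\in\mathsf H_m}{\text{minimize}}\;\;\sum_{i=1}^m\mathsf f_i(\mathsf x_i)+\sum_{k=1}^p\mathsf g_k\Big(\sum_{i=1}^m\mathsf L_{ki}\mathsf x_i\Big)$$ is nonempty. Let $$0<\vartheta\le\Big(\sum_{k=1}^p\tau_k\Big\|\sum_{i=1}^m\mathsf L_{ki}\mathsf L_{ki}^*\Big\|\Big)^{-1},$$ let $(\gamma_n)_{n\in\mathbb N}$ be a sequence in $]0,2\vartheta[$ such that $\inf_n\gamma_n>0$ and $\sup_n\gamma_n<2\vartheta$, and let $(\lambda_n)_{n\in\mathbb N}$ be a sequence in $]0,1]$ such that $\inf_n\lambda_n>0$. On a probability space $(\Omega,\mathcal F,\mathsf P)$, let $\boldsymbol x_0$, $(\boldsymbol a_n)_{n\in\mathbb N}$ and $(\boldsymbol c_n)_{n\in\mathbb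 N}$ be $\boldsymbol{\mathsf H}$-valued random variables and let $(\boldsymbol\varepsilon_n)_{n\in\mathbb N}$ be identically distributed $\mathsf D$-valued random variables. For $n=0,1,\dots$ and $i=1,\dots,m$ iterate $$r_{i,n}=\varepsilon_{i,n}\Big(x_{i,n}-\gamma_n\Big(\sum_{k=1}^p\mathsf L_{ki}^*\nabla\mathsf g_k\Big(\sum_{j=1}^m\mathsf L_{kj}x_{j,n}\Big)+c_{i,n}\Big)\Big),$$ $$x_{i,n+1}=x_{i,n}+\varepsilon_{i,n}\lambda_n\big(\mathrm{prox}_{\gamma_n\mathsf f_i}r_{i,n}+a_{i,n}-x_{i,n}\big).$$ Set $\boldsymbol x_n=(x_{1,n},\dots,x_{m,n})$, $\boldsymbol{\mathcal X}_n=\sigma(\boldsymbol x_0,\dots,\boldsymbol x_n)$ and $\boldsymbol{\mathcal E}_n=\sigma(\boldsymbol\varepsilon_n)$, and assume that: (i) $\sum_{n}\sqrt{\mathsf E(\|\boldsymbol a_n\|^2\mid\boldsymbol{\mathcal X}_n)}<+\infty$ and $\sum_{n}\sqrt{\mathsf E(\|\boldsymbol c_n\|^2\mid\boldsymbol{\mathcal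 X}_n)}<+\infty$ $\mathsf P$-almost surely, where the conditional expectations of these nonnegative random variables are $[0,+\infty]$-valued; (ii) for every $n\in\mathbb N$, $\boldsymbol{\mathcal E}_n$ and $\boldsymbol{\mathcal X}_n$ are independent; (iii) $\mathsf P[\varepsilon_{i,0}=1]>0$ for every $i\in\{1,\dots,m\}$. Then $(\boldsymbol x_n)_{n\in\mathbb N}$ converges weakly $\mathsf P$-almost surely to an $\boldsymbol{\mathsf F}$-valued random variable. -/

import Mathlib

open MeasureTheory ProbabilityTheory Filter Topology
open scoped NNReal ENNReal

noncomputable section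

/-- The class `Γ₀(E)`: lower semicontinuous convex functions `f : E → ]-∞, +∞]` that are not
identically `+∞`. -/
structure IsGammaZero {E : Type*} [NormedAddCommGroup E] [InnerProductSpace ℝ E]
    (f : E → EReal) : Prop where
  ne_bot : ∀ x, f x ≠ ⊥
  exists_ne_top : ∃ x, f x ≠ ⊤
  lowerSemicontinuous : LowerSemicontinuous f
  convex : ∀ x y : E, ∀ t : ℝ, 0 < t → t < 1 →
    f (t • x + (1 - t) • y) ≤ (t : EReal) * f x + ((1 - t : ℝ) : EReal) * f y

/-- The proximity operator: `proxOp f x` is a minimizer of `y ↦ f y + ‖x - y‖² / 2`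
(for `f ∈ Γ₀(E)` and `E` a Hilbert space, there is exactly one). -/
def proxOp {E : Type*} [NormedAddCommGroup E] [InnerProductSpace ℝ E]
    (f : E → EReal) (x : E) : E :=
  Classical.epsilon fun p : E =>
    IsMinOn (fun y : E => f y + ((‖x - y‖ ^ 2 / 2 : ℝ) : EReal)) Set.univ p

/-- Weak convergence of a sequence in a real Hilbert space. -/
def WeaklyConvergesTo {E : Type*} [NormedAddCommGroup E] [InnerProductSpace ℝ E]
    (u : ℕ → E) (l : E) : Prop :=
  ∀ y : E, Tendsto (fun n => inner ℝ (u n) y) atTop (𝓝 (inner ℝ l y))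

/-- The σ-algebra `σ(x₀, …, xₙ)` generated by the first `n + 1` terms of a sequence of maps
with values in a measurable space. -/
@[reducible] def pastSigma {Ω E : Type*} [MeasurableSpace E] (x : ℕ → Ω → E) (n : ℕ) : MeasurableSpace Ω :=
  ⨆ j ∈ Finset.range (n + 1), MeasurableSpace.comap (x j) inferInstance

/-- The set `{0,1}^m ∖ {0}` of admissible activation patterns. -/
def activationSet (m : ℕ) : Set (Fin m → ℝ) :=
  {d | (∀ i, d i = 0 ∨ d i = 1) ∧ d ≠ 0}

/-- The objective `x ↦ ∑ᵢ fᵢ(xᵢ) + ∑ₖ gₖ(∑ᵢ Lₖᵢ xᵢ)` on the direct Hilbert sum of the `Hᵢ`. -/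
def blockObjective {m p : ℕ} {H : Fin m → Type*} {G : Fin p → Type*}
    [∀ i, NormedAddCommGroup (H i)] [∀ i, InnerProductSpace ℝ (H i)]
    [∀ k, NormedAddCommGroup (G k)] [∀ k, InnerProductSpace ℝ (G k)]
    (f : ∀ i, H i → EReal) (g : ∀ k, G k → ℝ) (L : ∀ k i, H i →L[ℝ] G k)
    (x : PiLp 2 H) : EReal :=
  (∑ i, f i (x i)) + ((∑ k, g k (∑ i, L k i (x i)) : ℝ) : EReal)

/-- The set of global minimizers of the objective. -/
def blockSolutions {m p : ℕ} {H : Fin m → Type*} {G : Fin p → Type*}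
    [∀ i, NormedAddCommGroup (H i)] [∀ i, InnerProductSpace ℝ (H i)]
    [∀ k, NormedAddCommGroup (G k)] [∀ k, InnerProductSpace ℝ (G k)]
    (f : ∀ i, H i → EReal) (g : ∀ k, G k → ℝ) (L : ∀ k i, H i →L[ℝ] G k) :
    Set (PiLp 2 H) :=
  {x | IsMinOn (blockObjective f g L) Set.univ x}

end

/-! Let `B` be the gradient of the smooth term and let `T n` be the forward-backward operator, i.e.
the blockwise prox of `γ n • f i` applied to `x - γ n • B x`. By Baillon-Haddad and a weighted
Cauchy-Schwarz inequality, `B` is `ϑ`-cocoercive (`blockGradient_cocoercive`). As the prox is firmly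
nonexpansive, for every solution `z` the squared distance to `z` drops under `T n` by at least `θ`,
a sum of squares controlling `B x - B z` and `x - T n x` (`sq_norm_forwardBackward_sub_le`).

Random activation updates only some blocks, so the plain distance need not decrease on average. The
remedy is to weight block `i` by the inverse of its activation probability. Since `ε n` is
independent of the past, averaging over it turns the weighted squared distance into itself, minus
the plain squared distance before the step, plus the plain squared distance after a full relaxed
step (`condLE_sq_weightedNorm_step`). The decrease `lam n * θ` thus survives in conditional
expectation.

The errors add a perturbation with almost surely summable conditional size. The Robbins-Siegmund
theorem, used on the weighted distance and then on its square, gives almost sure convergence of the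
weighted distance to each solution and summability of `lam n * θ`
(`ae_tendsto_weightedNorm_and_summable`). The initial point need not be integrable, so conditional
bounds are stated as integral inequalities in `ℝ≥0∞` over events of the past (`CondLE`), and
Robbins-Siegmund is proved by localization.

A countable dense set of solutions yields one almost sure event on which all these distances
converge. There `B (x n)` converges strongly and `x n - T n (x n)` tends to zero, so weak cluster
points are solutions (`mem_blockSolutions_of_weaklyConvergesTo`), and Opial's argument leaves a
single one. The limit is measurable because it is weakly measurable and the space is separable. -/

/-! ### Subgradients, proximity operators and weak limits. -/

section ConvexAnalysis

lemma proxObjective_eq_top {E : Type*} [NormedAddCommGroup E] {f : E → EReal} {γ : ℝ} (hγ : 0 < γ)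
    (v : E) {y : E} (hy : f y = ⊤) :
    (γ : EReal) * f y + ((‖v - y‖ ^ 2 / 2 : ℝ) : EReal) = ⊤ := by
  rw [hy, EReal.coe_mul_top_of_pos hγ, EReal.top_add_coe]

variable {E : Type*} [NormedAddCommGroup E] [InnerProductSpace ℝ E]

/-- `u` is a subgradient of `f` at `x`, the inequality being written on the domain of `f`. -/
def HasSubgradient (f : E → EReal) (x u : E) : Prop :=
  f x ≠ ⊤ ∧ ∀ y, f y ≠ ⊤ → (f x).toReal + inner ℝ u (y - x) ≤ (f y).toReal

lemma IsGammaZero.le_coe_iff {f : E → EReal} (hf : IsGammaZero f) {x : E} {r : ℝ} :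
    f x ≤ r ↔ f x ≠ ⊤ ∧ (f x).toReal ≤ r := by
  constructor
  · intro h
    have h1 : f x ≠ ⊤ := fun h' => by rw [h'] at h; exact absurd h (by simp)
    refine ⟨h1, ?_⟩
    rw [← EReal.coe_toReal h1 (hf.ne_bot x)] at h
    exact_mod_cast h
  · rintro ⟨h1, h2⟩
    rw [← EReal.coe_toReal h1 (hf.ne_bot x)]
    exact_mod_cast h2

lemma IsGammaZero.convex_toReal {f : E → EReal} (hf : IsGammaZero f) {x y : E}
    (hx : f x ≠ ⊤) (hy : f y ≠ ⊤) {t : ℝ} (ht0 : 0 < t) (ht1 : t < 1) :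
    f (t • x + (1 - t) • y) ≠ ⊤ ∧
      (f (t • x + (1 - t) • y)).toReal ≤ t * (f x).toReal + (1 - t) * (f y).toReal := by
  rw [← hf.le_coe_iff]
  refine (hf.convex x y t ht0 ht1).trans ?_
  conv_lhs => rw [← EReal.coe_toReal hx (hf.ne_bot x), ← EReal.coe_toReal hy (hf.ne_bot y)]
  exact_mod_cast le_rfl

lemma HasSubgradient.monotone {f : E → EReal} {x y u v : E}
    (hx : HasSubgradient f x u) (hy : HasSubgradient f y v) : 0 ≤ inner ℝ (u - v) (x - y) := by
  have h1 := hx.2 y hy.1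
  have h2 := hy.2 x hx.1
  have h3 : inner ℝ u (y - x) = - inner ℝ u (x - y) := by rw [← inner_neg_right, neg_sub]
  rw [inner_sub_left]
  linarith

/-- If `a + s b ≤ s² c` for all small `s`, then the linear part is nonpositive. -/
lemma nonpos_of_forall_mul_le {b c : ℝ} (h : ∀ s : ℝ, 0 < s → s < 1 → s * b ≤ s ^ 2 * c) :
    b ≤ 0 := by
  by_contra! hb
  have hc : 0 < |c| + b := by positivity
  -- This `s` satisfies `s * (|c| + b) = b / 2`, so `s * c` stays below `b`, against `b ≤ s * c`.
  have hs0 : 0 < b / (2 * (|c| + b)) := by positivity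
  have hs1 : b / (2 * (|c| + b)) < 1 := by
    rw [div_lt_one (by positivity)]
    have := abs_nonneg c
    linarith
  have := h _ hs0 hs1
  set s := b / (2 * (|c| + b)) with hs
  have h1 : s * (2 * (|c| + b)) = b := by rw [hs]; field_simp
  have h2 : b ≤ s * c := by
    have : s * b ≤ s * (s * c) := by linarith [this, sq s, show s ^ 2 * c = s * (s * c) by ring]
    exact le_of_mul_le_mul_left this hs0
  have h3 : s * c ≤ s * |c| := mul_le_mul_of_nonneg_left (le_abs_self c) hs0.le
  nlinarith [mul_pos hs0 hb, mul_nonneg hs0.le (abs_nonneg c)]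

section Prox

variable {f : E → EReal} {γ : ℝ}

lemma proxObjective_eq (hf : IsGammaZero f) (v : E) {y : E} (hy : f y ≠ ⊤) :
    (γ : EReal) * f y + ((‖v - y‖ ^ 2 / 2 : ℝ) : EReal)
      = ((γ * (f y).toReal + ‖v - y‖ ^ 2 / 2 : ℝ) : EReal) := by
  conv_lhs => rw [← EReal.coe_toReal hy (hf.ne_bot y)]
  norm_cast

lemma isMinOn_proxObjective_iff (hf : IsGammaZero f) (hγ : 0 < γ) (v p : E) :
    IsMinOn (fun y : E => (γ : EReal) * f y + ((‖v - y‖ ^ 2 / 2 : ℝ) : EReal)) Set.univ p ↔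
      f p ≠ ⊤ ∧ ∀ y, f y ≠ ⊤ →
        γ * (f p).toReal + ‖v - p‖ ^ 2 / 2 ≤ γ * (f y).toReal + ‖v - y‖ ^ 2 / 2 := by
  rw [isMinOn_univ_iff]
  constructor
  · intro h
    obtain ⟨y0, hy0⟩ := hf.exists_ne_top
    have hp : f p ≠ ⊤ := by
      intro hp
      have := h y0
      rw [proxObjective_eq_top hγ v hp, proxObjective_eq hf v hy0] at this
      exact absurd this (not_le.2 (EReal.coe_lt_top _))
    refine ⟨hp, fun y hy => ?_⟩
    have := h y
    rw [proxObjective_eq hf v hp, proxObjective_eq hf v hy] at this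
    exact_mod_cast this
  · rintro ⟨hp, h⟩ y
    by_cases hy : f y = ⊤
    · rw [proxObjective_eq_top hγ v hy]; exact le_top
    · rw [proxObjective_eq hf v hp, proxObjective_eq hf v hy]
      exact_mod_cast h y hy

/-- Fermat's rule: compare `p` with the point at parameter `s` on the segment towards `y`. Convexity
makes the change linear in `s` up to a term in `s ^ 2`, which disappears as `s` tends to zero. -/
lemma hasSubgradient_of_isMinOn (hf : IsGammaZero f) (hγ : 0 < γ) {v p : E}
    (h : IsMinOn (fun y : E => (γ : EReal) * f y + ((‖v - y‖ ^ 2 / 2 : ℝ) : EReal)) Set.univ p) :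
    HasSubgradient f p (γ⁻¹ • (v - p)) := by
  obtain ⟨hp, h⟩ := (isMinOn_proxObjective_iff hf hγ v p).1 h
  refine ⟨hp, fun y hy => ?_⟩
  have key : γ * (f p).toReal + inner ℝ (v - p) (y - p) - γ * (f y).toReal ≤ 0 := by
    refine nonpos_of_forall_mul_le (c := ‖y - p‖ ^ 2 / 2) fun s hs0 hs1 => ?_
    obtain ⟨hs, hs'⟩ := hf.convex_toReal hy hp hs0 hs1
    have h1 := h _ hs
    have h2 : v - (s • y + (1 - s) • p) = (v - p) - s • (y - p) := by module
    rw [h2, norm_sub_sq_real (v - p) (s • (y - p)), inner_smul_right, norm_smul, mul_pow, Real.norm_eq_abs, sq_abs] at h1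
    have h3 := mul_le_mul_of_nonneg_left hs' hγ.le
    linarith
  rw [real_inner_smul_left]
  have : γ * ((f p).toReal + γ⁻¹ * inner ℝ (v - p) (y - p)) ≤ γ * (f y).toReal := by
    rw [mul_add, mul_inv_cancel_left₀ hγ.ne']
    linarith
  exact le_of_mul_le_mul_left this hγ

/-- The subgradient at `z` provides an affine minorant, so the objective is bounded below. Strong
convexity makes minimizing sequences Cauchy, and lower semicontinuity shows that the limit is a
minimizer. -/
lemma exists_isMinOn_proxObjective [CompleteSpace E] (hf : IsGammaZero f) (hγ : 0 < γ)
    {z b : E} (hz : HasSubgradient f z b) (v : E) :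
    ∃ p, IsMinOn (fun y : E => (γ : EReal) * f y + ((‖v - y‖ ^ 2 / 2 : ℝ) : EReal))
      Set.univ p := by
  let D := {y // f y ≠ ⊤}
  let φ : E → ℝ := fun y => γ * (f y).toReal + ‖v - y‖ ^ 2 / 2
  have : Nonempty D := ⟨⟨z, hz.1⟩⟩
  have hbdd : BddBelow (Set.range fun y : D => φ y) := by
    -- Affine minorant plus quadratic term, after completing the square in `(v - y) - γ • b`.
    refine ⟨γ * (f z).toReal + γ * inner ℝ b (v - z) - γ ^ 2 * ‖b‖ ^ 2 / 2, ?_⟩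
    rintro _ ⟨⟨y, hy⟩, rfl⟩
    have h1 := mul_le_mul_of_nonneg_left (hz.2 y hy) hγ.le
    have h2 : inner ℝ b (y - z) = inner ℝ b (v - z) - inner ℝ b (v - y) := by
      rw [← inner_sub_right]; congr 1; abel
    have h3 : 0 ≤ ‖(v - y) - γ • b‖ ^ 2 := by positivity
    rw [norm_sub_sq_real, inner_smul_right, norm_smul, mul_pow, Real.norm_eq_abs, sq_abs,
      real_inner_comm] at h3
    simp only [φ]
    rw [h2] at h1
    linarith
  set μ := ⨅ y : D, φ y with hμ
  have hlow : ∀ y, f y ≠ ⊤ → μ ≤ φ y := fun y hy => ciInf_le hbdd (⟨y, hy⟩ : D)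
  have hex : ∀ n : ℕ, ∃ y : D, φ y < μ + 1 / ((n : ℝ) + 1) := fun n =>
    exists_lt_of_ciInf_lt (by rw [← hμ]; linarith [Nat.one_div_pos_of_nat (α := ℝ) (n := n)])
  choose w hw using hex
  -- The midpoint has value at least `μ`, while the parallelogram law puts it `‖y - y'‖ ^ 2 / 8`
  -- below the average of `φ y` and `φ y'`.
  have hmid : ∀ y y' : D, ‖(y : E) - y'‖ ^ 2 ≤ 4 * (φ y + φ y' - 2 * μ) := by
    rintro ⟨y, hy⟩ ⟨y', hy'⟩
    obtain ⟨h1, h2⟩ := hf.convex_toReal hy hy' (t := 1 / 2) (by norm_num) (by norm_num)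
    have h3 := hlow _ h1
    simp only [φ] at h3 ⊢
    have h4 : v - ((1 / 2 : ℝ) • y + (1 - 1 / 2 : ℝ) • y')
        = (1 / 2 : ℝ) • ((v - y) + (v - y')) := by module
    have h5 := parallelogram_law_with_norm ℝ (v - y) (v - y')
    have h6 : (v - y) - (v - y') = y' - y := by abel
    rw [h6, norm_sub_rev y' y] at h5
    rw [h4, norm_smul, mul_pow, Real.norm_eq_abs, sq_abs] at h3
    have h7 := mul_le_mul_of_nonneg_left h2 hγ.le
    nlinarith
  have hcau : CauchySeq fun n => (w n : E) := by
    have hlim : Tendsto (fun n : ℕ => Real.sqrt (8 * (1 / ((n : ℝ) + 1)))) atTop (𝓝 0) := by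
      have := (tendsto_one_div_add_atTop_nhds_zero_nat (𝕜 := ℝ)).const_mul 8
      simpa using this.sqrt
    refine cauchySeq_of_le_tendsto_0 _ (fun n m N hn hm => ?_) hlim
    rw [dist_eq_norm]
    refine Real.le_sqrt_of_sq_le ((hmid (w n) (w m)).trans ?_)
    have h1 : 1 / ((n : ℝ) + 1) ≤ 1 / ((N : ℝ) + 1) :=
      one_div_le_one_div_of_le (by positivity) (by exact_mod_cast Nat.succ_le_succ hn)
    have h2 : 1 / ((m : ℝ) + 1) ≤ 1 / ((N : ℝ) + 1) :=
      one_div_le_one_div_of_le (by positivity) (by exact_mod_cast Nat.succ_le_succ hm)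
    linarith [hw n, hw m]
  obtain ⟨p, hp⟩ := cauchySeq_tendsto_of_complete hcau
  have hφ : Tendsto (fun n => φ (w n)) atTop (𝓝 μ) := by
    refine tendsto_of_tendsto_of_tendsto_of_le_of_le tendsto_const_nhds
      (h := fun n : ℕ => μ + 1 / ((n : ℝ) + 1)) ?_ (fun n => hlow _ (w n).2) (fun n => (hw n).le)
    simpa using (tendsto_one_div_add_atTop_nhds_zero_nat (𝕜 := ℝ)).const_add μ
  have hnorm : Tendsto (fun n => ‖v - w n‖ ^ 2 / 2) atTop (𝓝 (‖v - p‖ ^ 2 / 2)) :=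
    (((tendsto_const_nhds.sub hp).norm).pow 2).div_const 2
  have hfw : Tendsto (fun n => (f (w n)).toReal) atTop (𝓝 ((μ - ‖v - p‖ ^ 2 / 2) / γ)) := by
    have := (hφ.sub hnorm).div_const γ
    refine this.congr fun n => ?_
    simp only [φ]
    field_simp
    ring
  have hfp : f p ≤ (((μ - ‖v - p‖ ^ 2 / 2) / γ : ℝ) : EReal) := by
    refine EReal.le_of_forall_lt_iff_le.1 fun β hβ => ?_
    have hβ' : (μ - ‖v - p‖ ^ 2 / 2) / γ < β := by exact_mod_cast hβ
    have hcl := hf.lowerSemicontinuous.isClosed_preimage (β : EReal)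
    refine hcl.mem_of_tendsto hp ?_
    filter_upwards [hfw.eventually_lt_const hβ'] with n hn
    exact hf.le_coe_iff.2 ⟨(w n).2, hn.le⟩
  refine ⟨p, (isMinOn_proxObjective_iff hf hγ v p).2 ?_⟩
  obtain ⟨h1, h2⟩ := hf.le_coe_iff.1 hfp
  refine ⟨h1, fun y hy => le_trans ?_ (hlow y hy)⟩
  rw [le_div_iff₀ hγ] at h2
  linarith

variable [CompleteSpace E]

lemma hasSubgradient_proxOp (hf : IsGammaZero f) (hγ : 0 < γ) {z b : E}
    (hz : HasSubgradient f z b) (v : E) :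
    HasSubgradient f (proxOp (fun y => (γ : EReal) * f y) v)
      (γ⁻¹ • (v - proxOp (fun y => (γ : EReal) * f y) v)) :=
  hasSubgradient_of_isMinOn hf hγ
    (Classical.epsilon_spec (exists_isMinOn_proxObjective hf hγ hz v))

/-- Monotonicity of the subdifferential at the two prox points, whose subgradients are the scaled
residuals, makes the cross term in the expansion of `‖v - w‖ ^ 2` nonnegative. -/
lemma proxOp_firmly_nonexpansive (hf : IsGammaZero f) (hγ : 0 < γ) {z b : E}
    (hz : HasSubgradient f z b) (v w : E) :
    ‖proxOp (fun y => (γ : EReal) * f y) v - proxOp (fun y => (γ : EReal) * f y) w‖ ^ 2 ≤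
      ‖v - w‖ ^ 2 - ‖(v - proxOp (fun y => (γ : EReal) * f y) v)
        - (w - proxOp (fun y => (γ : EReal) * f y) w)‖ ^ 2 := by
  have h := (hasSubgradient_proxOp hf hγ hz v).monotone (hasSubgradient_proxOp hf hγ hz w)
  set p := proxOp (fun y => (γ : EReal) * f y) v
  set q := proxOp (fun y => (γ : EReal) * f y) w
  rw [← smul_sub, real_inner_smul_left] at h
  have h1 := nonneg_of_mul_nonneg_right h (inv_pos.2 hγ)
  have h2 : v - w = (v - p - (w - q)) + (p - q) := by abel
  rw [h2, norm_add_sq_real]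
  linarith

lemma lipschitzWith_proxOp (hf : IsGammaZero f) (hγ : 0 < γ) {z b : E}
    (hz : HasSubgradient f z b) : LipschitzWith 1 (proxOp (fun y => (γ : EReal) * f y)) := by
  refine LipschitzWith.of_dist_le_mul fun v w => ?_
  rw [dist_eq_norm, dist_eq_norm, NNReal.coe_one, one_mul]
  refine le_of_sq_le_sq ?_ (norm_nonneg _)
  have := proxOp_firmly_nonexpansive hf hγ hz v w
  nlinarith [sq_nonneg ‖(v - proxOp (fun y => (γ : EReal) * f y) v)
        - (w - proxOp (fun y => (γ : EReal) * f y) w)‖]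

/-- Monotonicity between the prox point `p` and `z` reads `-γ⁻¹ * ‖p - z‖ ^ 2 ≥ 0`. With `u = -B z`
this makes solutions fixed points of the forward-backward operator. -/
lemma proxOp_eq_of_hasSubgradient (hf : IsGammaZero f) (hγ : 0 < γ) {z u : E}
    (hz : HasSubgradient f z u) : proxOp (fun y => (γ : EReal) * f y) (z + γ • u) = z := by
  have h := (hasSubgradient_proxOp hf hγ hz (z + γ • u)).monotone hz
  set p := proxOp (fun y => (γ : EReal) * f y) (z + γ • u)
  have h1 : γ⁻¹ • (z + γ • u - p) - u = -(γ⁻¹ • (p - z)) := by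
    rw [add_sub_right_comm, smul_add, inv_smul_smul₀ hγ.ne', add_sub_cancel_right, ← smul_neg,
      neg_sub]
  rw [h1, inner_neg_left, real_inner_smul_left, real_inner_self_eq_norm_sq] at h
  have h2 : γ⁻¹ * ‖p - z‖ ^ 2 ≤ 0 := by linarith
  have h3 : ‖p - z‖ ^ 2 ≤ 0 := by
    by_contra! h'
    have := mul_pos (inv_pos.2 hγ) h'
    linarith
  rw [← sub_eq_zero, ← norm_eq_zero]
  exact pow_eq_zero_iff (two_ne_zero) |>.1 (le_antisymm h3 (sq_nonneg _))

end Prox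

/-- A closed convex set is weakly sequentially closed. -/
lemma WeaklyConvergesTo.mem_of_isClosed_of_convex [CompleteSpace E] {S : Set E} (hS : IsClosed S)
    (hc : Convex ℝ S) {u : ℕ → E} {l : E} (h : WeaklyConvergesTo u l) (hu : ∀ᶠ n in atTop, u n ∈ S) :
    l ∈ S := by
  by_contra hl
  obtain ⟨φ, a, h1, h2⟩ := geometric_hahn_banach_closed_point hc hS hl
  have h3 := h ((InnerProductSpace.toDual ℝ E).symm φ)
  simp only [fun v : E => real_inner_comm ((InnerProductSpace.toDual ℝ E).symm φ) v,
    InnerProductSpace.toDual_symm_apply] at h3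
  have : φ l ≤ a := le_of_tendsto h3 (hu.mono fun n hn => (h1 _ hn).le)
  linarith

lemma WeaklyConvergesTo.add_tendsto_zero {u w : ℕ → E} {l : E} (h : WeaklyConvergesTo u l)
    (hw : Tendsto w atTop (𝓝 0)) : WeaklyConvergesTo (fun n => u n + w n) l := by
  intro y
  have := (h y).add (hw.inner (tendsto_const_nhds (x := y)))
  simpa [inner_add_left] using this

/-- A bounded weakly convergent sequence can be paired with a strongly convergent one. -/
lemma WeaklyConvergesTo.tendsto_inner {u w : ℕ → E} {l b : E} (h : WeaklyConvergesTo u l)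
    {C : ℝ} (hC : ∀ n, ‖u n‖ ≤ C) (hw : Tendsto w atTop (𝓝 b)) :
    Tendsto (fun n => inner ℝ (w n) (u n)) atTop (𝓝 (inner ℝ b l)) := by
  have h1 : Tendsto (fun n => inner ℝ (w n - b) (u n)) atTop (𝓝 0) := by
    have h2 : Tendsto (fun n => ‖w n - b‖ * C) atTop (𝓝 0) := by
      have := (tendsto_iff_norm_sub_tendsto_zero.1 hw).mul_const C
      simpa using this
    refine squeeze_zero_norm (fun n => ?_) h2
    exact (norm_inner_le_norm _ _).trans (mul_le_mul_of_nonneg_left (hC n) (norm_nonneg _))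
  have h3 := h1.add (h b)
  simp only [inner_sub_left, zero_add] at h3
  rw [real_inner_comm]
  refine h3.congr fun n => ?_
  rw [real_inner_comm b (u n)]
  ring

lemma IsGammaZero.convex_sublevel {f : E → EReal} (hf : IsGammaZero f) (r : ℝ) :
    Convex ℝ {x | f x ≤ (r : EReal)} := by
  rw [convex_iff_forall_pos]
  intro x hx y hy s t hs ht hst
  obtain rfl : t = 1 - s := by linarith
  obtain ⟨h1, h2⟩ := hf.le_coe_iff.1 hx
  obtain ⟨h3, h4⟩ := hf.le_coe_iff.1 hy
  obtain ⟨h5, h6⟩ := hf.convex_toReal h1 h3 hs (by linarith)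
  refine hf.le_coe_iff.2 ⟨h5, h6.trans ?_⟩
  nlinarith

/-- The graph of the subdifferential is sequentially closed for the weak-strong topology. -/
lemma HasSubgradient.of_weaklyConvergesTo [CompleteSpace E] {f : E → EReal} (hf : IsGammaZero f)
    {t u : ℕ → E} {x b : E} (ht : WeaklyConvergesTo t x) {C : ℝ} (hC : ∀ n, ‖t n‖ ≤ C)
    (hu : Tendsto u atTop (𝓝 b)) (h : ∀ n, HasSubgradient f (t n) (u n)) :
    HasSubgradient f x b := by
  -- For fixed `y`, the values `f (t n)` lie below a convergent real sequence. Each level `β` above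
  -- its limit gives a closed convex sublevel set that eventually contains `t n`, hence contains
  -- `x`.
  have key : ∀ y, f y ≠ ⊤ → f x ≤ (((f y).toReal - inner ℝ b (y - x) : ℝ) : EReal) := by
    intro y hy
    refine EReal.le_of_forall_lt_iff_le.1 fun β hβ => ?_
    have hβ' : (f y).toReal - inner ℝ b (y - x) < β := by exact_mod_cast hβ
    have hlim : Tendsto (fun n => (f y).toReal - inner ℝ (u n) (y - t n)) atTop
        (𝓝 ((f y).toReal - inner ℝ b (y - x))) := by
      simp only [inner_sub_right]
      exact ((hu.inner tendsto_const_nhds).sub (ht.tendsto_inner hC hu)).const_sub _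
    refine ht.mem_of_isClosed_of_convex (hf.lowerSemicontinuous.isClosed_preimage (β : EReal))
      (hf.convex_sublevel β) ?_
    filter_upwards [hlim.eventually_lt_const hβ'] with n hn
    refine hf.le_coe_iff.2 ⟨(h n).1, ?_⟩
    linarith [(h n).2 y hy]
  obtain ⟨y0, hy0⟩ := hf.exists_ne_top
  refine ⟨(hf.le_coe_iff.1 (key y0 hy0)).1, fun y hy => ?_⟩
  linarith [(hf.le_coe_iff.1 (key y hy)).2]

end ConvexAnalysis

/-! ### Descent lemma and cocoercivity of Lipschitz gradients. -/

section SmoothConvex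

variable {G : Type*} [NormedAddCommGroup G] [InnerProductSpace ℝ G] [CompleteSpace G]
  {g : G → ℝ}

lemma hasDerivAt_comp_line (hd : Differentiable ℝ g) (x d : G) (s : ℝ) :
    HasDerivAt (fun s : ℝ => g (x + s • d)) (inner ℝ (gradient g (x + s • d)) d) s := by
  have h1 : HasDerivAt (fun s : ℝ => x + s • d) d s := by
    simpa using ((hasDerivAt_id s).smul_const d).const_add x
  have h2 := (hd (x + s • d)).hasGradientAt.hasFDerivAt.comp_hasDerivAt s h1
  exact h2.congr_deriv (by simp)

lemma ConvexOn.add_inner_gradient_le (hc : ConvexOn ℝ Set.univ g) (hd : Differentiable ℝ g)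
    (x y : G) : g x + inner ℝ (gradient g x) (y - x) ≤ g y := by
  have hconv : ConvexOn ℝ Set.univ (fun s : ℝ => g (x + s • (y - x))) := by
    have := hc.comp_affineMap (AffineMap.lineMap x y)
    rw [Set.preimage_univ] at this
    refine this.congr fun s _ => ?_
    simp [AffineMap.lineMap_apply, add_comm]
  have hder := hasDerivAt_comp_line hd x (y - x) 0
  have := hconv.le_slope_of_hasDerivAt (Set.mem_univ 0) (Set.mem_univ 1) zero_lt_one hder
  simp [slope_def_field] at this ⊢
  linarith

/-- Along the segment, the gap `h` between `g` and its quadratic model has nonpositive derivative by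
the Lipschitz bound, so `h 1 ≤ h 0`. -/
lemma LipschitzWith.le_add_inner_gradient_add_sq {K : ℝ≥0} (hd : Differentiable ℝ g)
    (hL : LipschitzWith K (gradient g)) (x d : G) :
    g (x + d) ≤ g x + inner ℝ (gradient g x) d + K / 2 * ‖d‖ ^ 2 := by
  let h : ℝ → ℝ := fun s => g (x + s • d) - (s * inner ℝ (gradient g x) d + K / 2 * s ^ 2 * ‖d‖ ^ 2)
  have hder : ∀ s, HasDerivAt h (inner ℝ (gradient g (x + s • d)) d -
      (inner ℝ (gradient g x) d + K * s * ‖d‖ ^ 2)) s := by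
    intro s
    have h1 := ((hasDerivAt_id s).mul_const (inner ℝ (gradient g x) d)).add
      (((hasDerivAt_pow 2 s).const_mul (K / 2 : ℝ)).mul_const (‖d‖ ^ 2))
    refine ((hasDerivAt_comp_line hd x d s).sub h1).congr_deriv ?_
    simp only [one_mul, Nat.cast_ofNat, Nat.add_one_sub_one, pow_one]
    ring
  have hanti : AntitoneOn h (Set.Icc 0 1) := by
    refine antitoneOn_of_deriv_nonpos (convex_Icc 0 1)
      (fun s _ => (hder s).continuousAt.continuousWithinAt)
      (fun s _ => (hder s).differentiableAt.differentiableWithinAt) fun s hs => ?_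
    rw [interior_Icc] at hs
    rw [(hder s).deriv]
    have h1 : inner ℝ (gradient g (x + s • d) - gradient g x) d ≤ K * s * ‖d‖ ^ 2 := by
      refine (real_inner_le_norm _ _).trans ?_
      have h2 := hL.norm_sub_le (x + s • d) x
      rw [add_sub_cancel_left, norm_smul, Real.norm_eq_abs, abs_of_pos hs.1] at h2
      calc _ ≤ (K * (s * ‖d‖)) * ‖d‖ := mul_le_mul_of_nonneg_right h2 (norm_nonneg _)
        _ = _ := by ring
    rw [inner_sub_left] at h1
    linarith
  have := hanti (Set.left_mem_Icc.2 zero_le_one) (Set.right_mem_Icc.2 zero_le_one) zero_le_one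
  simp [h] at this ⊢
  linarith

/-- At `y + d`, the tangent at `x` bounds `g` from below and the descent lemma from `y` bounds it
from above. The gradient step `d = -K⁻¹ • (∇g y - ∇g x)` makes the comparison sharpest. -/
lemma ConvexOn.add_sq_gradient_sub_le {K : ℝ≥0} (hK : 0 < K) (hc : ConvexOn ℝ Set.univ g)
    (hd : Differentiable ℝ g) (hL : LipschitzWith K (gradient g)) (x y : G) :
    g x + inner ℝ (gradient g x) (y - x) + ‖gradient g y - gradient g x‖ ^ 2 / (2 * K) ≤ g y := by
  have hK' : (0 : ℝ) < K := by exact_mod_cast hK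
  set w := gradient g y - gradient g x with hw
  set d : G := -((K : ℝ)⁻¹ • w) with hdef
  have h1 := hc.add_inner_gradient_le hd x (y + d)
  have h2 := LipschitzWith.le_add_inner_gradient_add_sq hd hL y d
  have h3 : y + d - x = (y - x) + d := by abel
  rw [h3, inner_add_right] at h1
  have h4 : inner ℝ (gradient g y) d - inner ℝ (gradient g x) d = -((K : ℝ)⁻¹ * ‖w‖ ^ 2) := by
    rw [← inner_sub_left, ← hw, hdef, inner_neg_right, inner_smul_right,
      real_inner_self_eq_norm_sq]
  have h5 : ‖d‖ ^ 2 = (K : ℝ)⁻¹ ^ 2 * ‖w‖ ^ 2 := by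
    rw [hdef, norm_neg, norm_smul, mul_pow, Real.norm_eq_abs, sq_abs]
  have h6 : (K : ℝ) / 2 * ‖d‖ ^ 2 = (K : ℝ)⁻¹ * ‖w‖ ^ 2 / 2 := by
    rw [h5]; field_simp
  have h7 : ‖w‖ ^ 2 / (2 * K) = (K : ℝ)⁻¹ * ‖w‖ ^ 2 / 2 := by field_simp
  rw [h7]
  linarith

/-- The Baillon-Haddad theorem: the gradient of a convex function with a `K`-Lipschitz gradient is
`K⁻¹`-cocoercive. -/
lemma ConvexOn.sq_gradient_sub_le_inner {K : ℝ≥0} (hK : 0 < K) (hc : ConvexOn ℝ Set.univ g)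
    (hd : Differentiable ℝ g) (hL : LipschitzWith K (gradient g)) (x y : G) :
    ‖gradient g x - gradient g y‖ ^ 2 ≤
      K * inner ℝ (gradient g x - gradient g y) (x - y) := by
  have hK' : (0 : ℝ) < K := by exact_mod_cast hK
  -- Exchanging the two points and adding cancels the values of `g`.
  have h1 := hc.add_sq_gradient_sub_le hK hd hL x y
  have h2 := hc.add_sq_gradient_sub_le hK hd hL y x
  rw [norm_sub_rev] at h1
  have h3 : inner ℝ (gradient g x) (y - x) = - inner ℝ (gradient g x) (x - y) := by
    rw [← inner_neg_right, neg_sub]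
  rw [inner_sub_left]
  have h4 : ‖gradient g x - gradient g y‖ ^ 2 / K ≤
      inner ℝ (gradient g x) (x - y) - inner ℝ (gradient g y) (x - y) := by
    have : ‖gradient g x - gradient g y‖ ^ 2 / K =
      2 * (‖gradient g x - gradient g y‖ ^ 2 / (2 * K)) := by field_simp
    rw [this]
    linarith
  rw [div_le_iff₀ hK'] at h4
  linarith

end SmoothConvex

/-! ### The smooth term on the direct sum and its cocoercive gradient. -/

noncomputable section BlockGradient

variable {m p : ℕ} {H : Fin m → Type*} {G : Fin p → Type*}
  [∀ i, NormedAddCommGroup (H i)] [∀ i, InnerProductSpace ℝ (H i)]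
  [∀ k, NormedAddCommGroup (G k)] [∀ k, InnerProductSpace ℝ (G k)]

/-- The operator `x ↦ ∑ i, L k i (x i)` on the direct Hilbert sum. -/
def rowMap (L : ∀ k i, H i →L[ℝ] G k) (k : Fin p) : PiLp 2 H →L[ℝ] G k :=
  ∑ i, (L k i).comp (PiLp.proj 2 H i)

@[simp] lemma rowMap_apply (L : ∀ k i, H i →L[ℝ] G k) (k : Fin p) (x : PiLp 2 H) :
    rowMap L k x = ∑ i, L k i (x i) := by
  simp [rowMap]

variable [∀ i, CompleteSpace (H i)] [∀ k, CompleteSpace (G k)]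

/-- The gradient of `x ↦ ∑ k, g k (∑ i, L k i (x i))`. -/
def blockGradient (g : ∀ k, G k → ℝ) (L : ∀ k i, H i →L[ℝ] G k) (x : PiLp 2 H) : PiLp 2 H :=
  WithLp.toLp 2 fun i => ∑ k, ContinuousLinearMap.adjoint (L k i)
    (gradient (g k) (∑ j, L k j (x j)))

lemma adjoint_rowMap_apply (L : ∀ k i, H i →L[ℝ] G k) (k : Fin p) (v : G k) (i : Fin m) :
    ContinuousLinearMap.adjoint (rowMap L k) v i = ContinuousLinearMap.adjoint (L k i) v := by
  have : ContinuousLinearMap.adjoint (rowMap L k) v =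
      WithLp.toLp 2 fun i => ContinuousLinearMap.adjoint (L k i) v := by
    refine ext_inner_right ℝ fun w => ?_
    rw [ContinuousLinearMap.adjoint_inner_left, PiLp.inner_apply, rowMap_apply, inner_sum]
    simp [ContinuousLinearMap.adjoint_inner_left]
  rw [this]

/-- The C*-identity applied to the adjoint of the row operator; it explains the norms in the bound
on `ϑ`. -/
lemma sq_norm_rowMap (L : ∀ k i, H i →L[ℝ] G k) (k : Fin p) :
    ‖rowMap L k‖ ^ 2 = ‖∑ i, (L k i).comp (ContinuousLinearMap.adjoint (L k i))‖ := by
  have h1 : (rowMap L k).comp (ContinuousLinearMap.adjoint (rowMap L k)) =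
      ∑ i, (L k i).comp (ContinuousLinearMap.adjoint (L k i)) := by
    ext v
    simp [adjoint_rowMap_apply]
  rw [← h1]
  have := ContinuousLinearMap.norm_adjoint_comp_self (ContinuousLinearMap.adjoint (rowMap L k))
  rw [ContinuousLinearMap.adjoint_adjoint, LinearIsometryEquiv.norm_map] at this
  rw [this, sq]

lemma blockGradient_eq (g : ∀ k, G k → ℝ) (L : ∀ k i, H i →L[ℝ] G k) (x : PiLp 2 H) :
    blockGradient g L x = ∑ k, ContinuousLinearMap.adjoint (rowMap L k)
      (gradient (g k) (rowMap L k x)) := by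
  ext i
  simp [blockGradient, adjoint_rowMap_apply]

lemma inner_blockGradient (g : ∀ k, G k → ℝ) (L : ∀ k i, H i →L[ℝ] G k) (x y : PiLp 2 H) :
    inner ℝ (blockGradient g L x) y =
      ∑ k, inner ℝ (gradient (g k) (rowMap L k x)) (rowMap L k y) := by
  simp only [blockGradient_eq, sum_inner, ContinuousLinearMap.adjoint_inner_left]

variable {τ : Fin p → ℝ≥0} {g : ∀ k, G k → ℝ} {L : ∀ k i, H i →L[ℝ] G k} {ϑ : ℝ}

/-- Baillon-Haddad bounds the inner product below by `∑ k, ‖d k‖ ^ 2 / τ k`. Cauchy-Schwarz with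
weights `τ k` bounds the squared norm by `S` times this sum, and `ϑ * S ≤ 1`. -/
lemma blockGradient_cocoercive (hτ : ∀ k, 0 < τ k) (hg_convex : ∀ k, ConvexOn ℝ Set.univ (g k))
    (hg_diff : ∀ k, Differentiable ℝ (g k)) (hg_lip : ∀ k, LipschitzWith (τ k) (gradient (g k)))
    (hϑ_pos : 0 < ϑ) (hϑ_le : ϑ ≤ (∑ k, (τ k : ℝ) *
      ‖∑ i, (L k i).comp (ContinuousLinearMap.adjoint (L k i))‖)⁻¹) (x y : PiLp 2 H) :
    ϑ * ‖blockGradient g L x - blockGradient g L y‖ ^ 2 ≤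
      inner ℝ (blockGradient g L x - blockGradient g L y) (x - y) := by
  set S := ∑ k, (τ k : ℝ) * ‖∑ i, (L k i).comp (ContinuousLinearMap.adjoint (L k i))‖ with hS
  -- Since `0⁻¹ = 0`, the condition `0 < ϑ ≤ S⁻¹` already excludes `S = 0`.
  have hSpos : 0 < S := inv_pos.1 (hϑ_pos.trans_le hϑ_le)
  set d : ∀ k, G k := fun k => gradient (g k) (rowMap L k x) - gradient (g k) (rowMap L k y)
  have hτ' : ∀ k, (0 : ℝ) < τ k := fun k => by exact_mod_cast hτ k
  have h1 : blockGradient g L x - blockGradient g L y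
      = ∑ k, ContinuousLinearMap.adjoint (rowMap L k) (d k) := by
    simp only [blockGradient_eq, ← Finset.sum_sub_distrib, ← map_sub, d]
  have h2 : ∑ k, ‖d k‖ ^ 2 / τ k ≤
      inner ℝ (blockGradient g L x - blockGradient g L y) (x - y) := by
    rw [h1, sum_inner]
    refine Finset.sum_le_sum fun k _ => ?_
    rw [ContinuousLinearMap.adjoint_inner_left, div_le_iff₀ (hτ' k), map_sub, mul_comm]
    exact (hg_convex k).sq_gradient_sub_le_inner (hτ k) (hg_diff k) (hg_lip k) _ _
  have h3 : ‖blockGradient g L x - blockGradient g L y‖ ^ 2 ≤ S * ∑ k, ‖d k‖ ^ 2 / τ k := by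
    have h4 : ‖blockGradient g L x - blockGradient g L y‖ ≤ ∑ k, ‖rowMap L k‖ * ‖d k‖ := by
      rw [h1]
      refine norm_sum_le_of_le _ fun k _ => ?_
      refine (ContinuousLinearMap.le_opNorm _ _).trans ?_
      rw [LinearIsometryEquiv.norm_map]
    refine (pow_le_pow_left₀ (norm_nonneg _) h4 2).trans ?_
    refine Finset.sum_sq_le_sum_mul_sum_of_sq_le_mul _ (fun k _ => by positivity)
      (fun k _ => by have := hτ' k; positivity) fun k _ => ?_
    rw [← sq_norm_rowMap]
    have := (hτ' k).ne'
    exact le_of_eq (by field_simp)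
  have h5 : ϑ * S ≤ 1 := by
    calc ϑ * S ≤ S⁻¹ * S := mul_le_mul_of_nonneg_right hϑ_le hSpos.le
      _ = 1 := inv_mul_cancel₀ hSpos.ne'
  have h6 : 0 ≤ ∑ k, ‖d k‖ ^ 2 / τ k := Finset.sum_nonneg fun k _ => by
    have := hτ' k; positivity
  calc _ ≤ ϑ * (S * ∑ k, ‖d k‖ ^ 2 / τ k) := mul_le_mul_of_nonneg_left h3 hϑ_pos.le
    _ = (ϑ * S) * ∑ k, ‖d k‖ ^ 2 / τ k := by ring
    _ ≤ 1 * ∑ k, ‖d k‖ ^ 2 / τ k := mul_le_mul_of_nonneg_right h5 h6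
    _ ≤ _ := by rw [one_mul]; exact h2

lemma continuous_blockGradient (hg_lip : ∀ k, LipschitzWith (τ k) (gradient (g k))) :
    Continuous (blockGradient g L) := by
  have : blockGradient g L = fun x => ∑ k, ContinuousLinearMap.adjoint (rowMap L k)
      (gradient (g k) (rowMap L k x)) := funext (blockGradient_eq g L)
  rw [this]
  refine continuous_finsetSum _ fun k _ => ?_
  exact (ContinuousLinearMap.continuous _).comp
    ((hg_lip k).continuous.comp (ContinuousLinearMap.continuous _))

/-- The smooth part of the objective lies above its tangents. -/
lemma add_inner_blockGradient_le (hg_convex : ∀ k, ConvexOn ℝ Set.univ (g k))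
    (hg_diff : ∀ k, Differentiable ℝ (g k)) (x y : PiLp 2 H) :
    ∑ k, g k (∑ i, L k i (x i)) + inner ℝ (blockGradient g L x) (y - x)
      ≤ ∑ k, g k (∑ i, L k i (y i)) := by
  simp only [← rowMap_apply, inner_blockGradient, map_sub, ← Finset.sum_add_distrib]
  exact Finset.sum_le_sum fun k _ => (hg_convex k).add_inner_gradient_le (hg_diff k) _ _

/-- The descent lemma for the smooth part of the objective. -/
lemma exists_le_add_inner_blockGradient_add_sq (hg_diff : ∀ k, Differentiable ℝ (g k))
    (hg_lip : ∀ k, LipschitzWith (τ k) (gradient (g k))) (x d : PiLp 2 H) :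
    ∃ C : ℝ, ∀ s : ℝ, ∑ k, g k (∑ i, L k i ((x + s • d) i)) ≤
      ∑ k, g k (∑ i, L k i (x i)) + s * inner ℝ (blockGradient g L x) d + s ^ 2 * C := by
  refine ⟨∑ k, (τ k / 2 * ‖rowMap L k d‖ ^ 2 : ℝ), fun s => ?_⟩
  simp only [← rowMap_apply, inner_blockGradient, map_add, map_smul, Finset.mul_sum,
    ← Finset.sum_add_distrib]
  refine Finset.sum_le_sum fun k _ => ?_
  have := LipschitzWith.le_add_inner_gradient_add_sq (hg_diff k) (hg_lip k) (rowMap L k x)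
    (s • rowMap L k d)
  rw [inner_smul_right, norm_smul, mul_pow, Real.norm_eq_abs, sq_abs] at this
  linarith

end BlockGradient

/-! ### Optimality conditions and the forward-backward operator. -/

noncomputable section BlockSplitting

variable {m p : ℕ} {H : Fin m → Type*} {G : Fin p → Type*}
  [∀ i, NormedAddCommGroup (H i)] [∀ i, InnerProductSpace ℝ (H i)]
  [∀ k, NormedAddCommGroup (G k)] [∀ k, InnerProductSpace ℝ (G k)]
  {f : ∀ i, H i → EReal} {g : ∀ k, G k → ℝ} {L : ∀ k i, H i →L[ℝ] G k}

/-- One error-free step of the block forward-backward method. -/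
def forwardBackward (f : ∀ i, H i → EReal) (B : PiLp 2 H → PiLp 2 H) (γ : ℝ) (x : PiLp 2 H) :
    PiLp 2 H :=
  WithLp.toLp 2 fun i => proxOp (fun y => (γ : EReal) * f i y) (x i - γ • B x i)

lemma EReal.sum_eq_coe {ι : Type*} (s : Finset ι) {a : ι → EReal} (hb : ∀ i, a i ≠ ⊥)
    (ht : ∀ i, a i ≠ ⊤) : ∑ i ∈ s, a i = ((∑ i ∈ s, (a i).toReal : ℝ) : EReal) := by
  classical
  induction s using Finset.induction_on with
  | empty => simp
  | insert i s hi ih =>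
    rw [Finset.sum_insert hi, Finset.sum_insert hi, ih, EReal.coe_add,
      EReal.coe_toReal (ht i) (hb i)]

lemma EReal.sum_ne_bot {ι : Type*} (s : Finset ι) {a : ι → EReal} (hb : ∀ i, a i ≠ ⊥) :
    ∑ i ∈ s, a i ≠ ⊥ := by
  classical
  induction s using Finset.induction_on with
  | empty => simp
  | insert i s hi ih =>
    rw [Finset.sum_insert hi]
    exact fun h => (EReal.add_eq_bot_iff.1 h).elim (hb i) ih

lemma EReal.sum_eq_top {ι : Type*} {s : Finset ι} {a : ι → EReal} (hb : ∀ i, a i ≠ ⊥)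
    {i : ι} (hi : i ∈ s) (ht : a i = ⊤) : ∑ i ∈ s, a i = ⊤ := by
  classical
  rw [← Finset.add_sum_erase s a hi, ht, EReal.top_add_of_ne_bot (EReal.sum_ne_bot _ hb)]

lemma mem_blockSolutions_iff (hf : ∀ i, IsGammaZero (f i)) (x : PiLp 2 H) :
    x ∈ blockSolutions f g L ↔ (∀ i, f i (x i) ≠ ⊤) ∧ ∀ y : PiLp 2 H, (∀ i, f i (y i) ≠ ⊤) →
      ∑ i, (f i (x i)).toReal + ∑ k, g k (∑ i, L k i (x i)) ≤
        ∑ i, (f i (y i)).toReal + ∑ k, g k (∑ i, L k i (y i)) := by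
  have hfin : ∀ y : PiLp 2 H, (∀ i, f i (y i) ≠ ⊤) → blockObjective f g L y =
      ((∑ i, (f i (y i)).toReal + ∑ k, g k (∑ i, L k i (y i)) : ℝ) : EReal) := fun y hy => by
    rw [blockObjective, EReal.sum_eq_coe _ (fun i => (hf i).ne_bot _) hy, EReal.coe_add]
  have htop : ∀ y : PiLp 2 H, ∀ i, f i (y i) = ⊤ → blockObjective f g L y = ⊤ := fun y i hi => by
    rw [blockObjective, EReal.sum_eq_top (fun i => (hf i).ne_bot _) (Finset.mem_univ i) hi,
      EReal.top_add_coe]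
  rw [blockSolutions, Set.mem_ofPred_eq, isMinOn_univ_iff]
  constructor
  · intro h
    have hx : ∀ i, f i (x i) ≠ ⊤ := by
      intro i hi
      choose y0 hy0 using fun i => (hf i).exists_ne_top
      have := h (WithLp.toLp 2 y0)
      rw [htop x i hi, hfin (WithLp.toLp 2 y0) hy0] at this
      exact absurd this (not_le.2 (EReal.coe_lt_top _))
    refine ⟨hx, fun y hy => ?_⟩
    have := h y
    rw [hfin x hx, hfin y hy] at this
    exact_mod_cast this
  · rintro ⟨hx, h⟩ y
    by_cases hy : ∀ i, f i (y i) ≠ ⊤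
    · rw [hfin x hx, hfin y hy]
      exact_mod_cast h y hy
    · push Not at hy
      obtain ⟨i, hi⟩ := hy
      rw [htop y i hi]
      exact le_top

/-- The vector `b` is only required to be a subgradient of the smooth term at `x`. At a weak limit
it can then be the strong limit of the gradients, with no need to identify it as the gradient there.
-/
lemma mem_blockSolutions_of_hasSubgradient (hf : ∀ i, IsGammaZero (f i)) {x b : PiLp 2 H}
    (hx : ∀ i, HasSubgradient (f i) (x i) (-(b i)))
    (hb : ∀ y : PiLp 2 H, ∑ k, g k (∑ i, L k i (x i)) + inner ℝ b (y - x)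
      ≤ ∑ k, g k (∑ i, L k i (y i))) : x ∈ blockSolutions f g L := by
  refine (mem_blockSolutions_iff hf x).2 ⟨fun i => (hx i).1, fun y hy => ?_⟩
  have h1 := hb y
  have h2 : ∑ i, ((f i (x i)).toReal - inner ℝ (b i) (y i - x i)) ≤ ∑ i, (f i (y i)).toReal := by
    refine Finset.sum_le_sum fun i _ => ?_
    have := (hx i).2 (y i) (hy i)
    rw [inner_neg_left] at this
    linarith
  rw [PiLp.inner_apply] at h1
  simp only [PiLp.sub_apply] at h1
  rw [Finset.sum_sub_distrib] at h2
  linarith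

lemma WeaklyConvergesTo.apply {u : ℕ → PiLp 2 H} {l : PiLp 2 H} (h : WeaklyConvergesTo u l)
    (i : Fin m) : WeaklyConvergesTo (fun n => u n i) (l i) := by
  have hin : ∀ (v : PiLp 2 H) (y : H i), inner ℝ v (PiLp.single 2 i y) = inner ℝ (v i) y := by
    intro v y
    rw [PiLp.inner_apply, Finset.sum_eq_single i]
    · simp
    · intro j _ hj
      simp [hj]
    · simp
  intro y
  simpa only [hin] using h (PiLp.single 2 i y)

variable [∀ i, CompleteSpace (H i)] [∀ k, CompleteSpace (G k)] {τ : Fin p → ℝ≥0}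

/-- The optimality condition satisfied by the solutions, block by block. -/
lemma hasSubgradient_of_mem_blockSolutions (hf : ∀ i, IsGammaZero (f i))
    (hg_diff : ∀ k, Differentiable ℝ (g k)) (hg_lip : ∀ k, LipschitzWith (τ k) (gradient (g k)))
    {z : PiLp 2 H} (hz : z ∈ blockSolutions f g L) (i : Fin m) :
    HasSubgradient (f i) (z i) (-(blockGradient g L z i)) := by
  obtain ⟨hz, hmin⟩ := (mem_blockSolutions_iff hf z).1 hz
  refine ⟨hz i, fun w hw => ?_⟩
  -- Only block `i` is moved, towards `w`; minimality at first order in `s` is the claim, and the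
  -- descent lemma confines the remainder to `s ^ 2 * C`.
  obtain ⟨C, hC⟩ := exists_le_add_inner_blockGradient_add_sq (L := L) hg_diff hg_lip z
    (PiLp.single 2 i (w - z i))
  have hin : inner ℝ (blockGradient g L z) (PiLp.single 2 i (w - z i))
      = inner ℝ (blockGradient g L z i) (w - z i) := by
    rw [PiLp.inner_apply, Finset.sum_eq_single i]
    · simp
    · intro j _ hj
      simp [hj]
    · simp
  rw [inner_neg_left]
  have key : (f i (z i)).toReal - inner ℝ (blockGradient g L z i) (w - z i)
      - (f i w).toReal ≤ 0 := by
    refine nonpos_of_forall_mul_le (c := C) fun s hs0 hs1 => ?_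
    obtain ⟨h1, h2⟩ := (hf i).convex_toReal hw (hz i) hs0 hs1
    have hne : ∀ j, j ≠ i → (z + s • PiLp.single 2 i (w - z i) : PiLp 2 H) j = z j := by
      intro j hj
      simp [hj]
    have hii : (z + s • PiLp.single 2 i (w - z i) : PiLp 2 H) i = s • w + (1 - s) • z i := by
      simp only [PiLp.add_apply, PiLp.smul_apply, PiLp.single_eq_same]
      module
    have h3 := hmin (z + s • PiLp.single 2 i (w - z i)) fun j => by
      by_cases hj : j = i
      · subst hj; rw [hii]; exact h1
      · rw [hne j hj]; exact hz j
    have h4 := hC s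
    rw [hin] at h4
    have h5 : ∑ j, (f j ((z + s • PiLp.single 2 i (w - z i) : PiLp 2 H) j)).toReal
        - ∑ j, (f j (z j)).toReal =
        (f i (s • w + (1 - s) • z i)).toReal - (f i (z i)).toReal := by
      rw [← Finset.sum_sub_distrib, Finset.sum_eq_single i]
      · rw [hii]
      · intro j _ hj
        rw [hne j hj, sub_self]
      · simp
    linarith
  linarith

/-- Since `z` is a fixed point, firm nonexpansiveness summed over the blocks yields the last square.
Cocoercivity in the expansion of `‖(x - z) - γ • (B x - B z)‖ ^ 2` yields the factor `γ * (2 * ϑ -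
γ)`. -/
lemma sq_norm_forwardBackward_sub_le (hf : ∀ i, IsGammaZero (f i)) {B : PiLp 2 H → PiLp 2 H}
    {ϑ γ : ℝ} (hB : ∀ x y, ϑ * ‖B x - B y‖ ^ 2 ≤ inner ℝ (B x - B y) (x - y)) (hγ : 0 < γ)
    {z : PiLp 2 H} (hz : ∀ i, HasSubgradient (f i) (z i) (-(B z i))) (x : PiLp 2 H) :
    ‖forwardBackward f B γ x - z‖ ^ 2 ≤ ‖x - z‖ ^ 2 - γ * (2 * ϑ - γ) * ‖B x - B z‖ ^ 2
      - ‖(x - forwardBackward f B γ x) - γ • (B x - B z)‖ ^ 2 := by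
  set t := forwardBackward f B γ x with ht
  have h1 : ‖t - z‖ ^ 2 ≤ ‖(x - z) - γ • (B x - B z)‖ ^ 2 - ‖(x - t) - γ • (B x - B z)‖ ^ 2 := by
    simp only [PiLp.norm_sq_eq_of_L2, ← Finset.sum_sub_distrib]
    refine Finset.sum_le_sum fun i _ => ?_
    have h2 := proxOp_firmly_nonexpansive (hf i) hγ (hz i) (x i - γ • B x i)
      (z i + γ • -(B z i))
    rw [proxOp_eq_of_hasSubgradient (hf i) hγ (hz i)] at h2
    have h3 : t i = proxOp (fun y => (γ : EReal) * f i y) (x i - γ • B x i) := rfl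
    rw [← h3] at h2
    simp only [PiLp.sub_apply, PiLp.smul_apply]
    have h6 : x i - γ • B x i - (z i + γ • -(B z i)) = x i - z i - γ • (B x i - B z i) := by
      module
    have h7 : x i - γ • B x i - t i - (z i + γ • -(B z i) - z i)
        = x i - t i - γ • (B x i - B z i) := by module
    rwa [h6, h7] at h2
  have h4 := hB x z
  have h5 : ‖(x - z) - γ • (B x - B z)‖ ^ 2 ≤ ‖x - z‖ ^ 2 - γ * (2 * ϑ - γ) * ‖B x - B z‖ ^ 2 := by
    rw [norm_sub_sq_real, inner_smul_right, norm_smul, mul_pow, Real.norm_eq_abs, sq_abs,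
      real_inner_comm]
    nlinarith [mul_le_mul_of_nonneg_left h4 hγ.le]
  linarith

/-- Weak limits of approximate fixed points of the forward-backward operators are solutions. -/
lemma mem_blockSolutions_of_weaklyConvergesTo (hf : ∀ i, IsGammaZero (f i))
    (hg_convex : ∀ k, ConvexOn ℝ Set.univ (g k)) (hg_diff : ∀ k, Differentiable ℝ (g k))
    (hne : ∀ i, ∃ z b, HasSubgradient (f i) z b)
    {γ : ℕ → ℝ} {γmin : ℝ} (hγmin : 0 < γmin) (hγ : ∀ n, γmin ≤ γ n)
    {x : ℕ → PiLp 2 H} {l b : PiLp 2 H} (hx : WeaklyConvergesTo x l) {C : ℝ} (hC : ∀ n, ‖x n‖ ≤ C)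
    (hb : Tendsto (fun n => blockGradient g L (x n)) atTop (𝓝 b))
    (ht : Tendsto (fun n => x n - forwardBackward f (blockGradient g L) (γ n) (x n)) atTop (𝓝 0)) :
    l ∈ blockSolutions f g L := by
  set t := fun n => forwardBackward f (blockGradient g L) (γ n) (x n) with htdef
  have hγ0 : ∀ n, 0 < γ n := fun n => hγmin.trans_le (hγ n)
  have htw : WeaklyConvergesTo t l := by
    have := hx.add_tendsto_zero (by simpa using ht.neg)
    simpa [t] using this
  obtain ⟨C', hC'⟩ : ∃ C', ∀ n, ‖t n‖ ≤ C' := by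
    obtain ⟨D, hD⟩ := ht.norm.bddAbove_range
    refine ⟨C + D, fun n => ?_⟩
    have h1 : ‖x n - t n‖ ≤ D := hD ⟨n, rfl⟩
    have h2 : t n = x n - (x n - t n) := by abel
    rw [h2]
    exact (norm_sub_le _ _).trans (add_le_add (hC n) h1)
  have happ : ∀ i : Fin m, Continuous fun v : PiLp 2 H => v i := fun i =>
    (PiLp.proj (𝕜 := ℝ) 2 H i).continuous
  refine mem_blockSolutions_of_hasSubgradient hf (b := b) (fun i => ?_) fun y => ?_
  · obtain ⟨z, c, hz⟩ := hne i
    refine HasSubgradient.of_weaklyConvergesTo (hf i) (htw.apply i) (C := C')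
      (fun n => (PiLp.norm_apply_le (t n) i).trans (hC' n)) ?_
      (fun n => hasSubgradient_proxOp (hf i) (hγ0 n) hz
        (x n i - γ n • blockGradient g L (x n) i))
    -- The subgradient at `t n i` is this vector minus block `i` of the gradient. The lower bound on
    -- `γ` makes it vanish, leaving `-(b i)`.
    have h1 : Tendsto (fun n => (γ n)⁻¹ • (x n i - t n i)) atTop (𝓝 0) := by
      have h2 : Tendsto (fun n => x n i - t n i) atTop (𝓝 0) := by
        exact ((happ i).tendsto 0).comp ht
      have h3 : Tendsto (fun n => γmin⁻¹ * ‖x n i - t n i‖) atTop (𝓝 0) := by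
        simpa using h2.norm.const_mul γmin⁻¹
      refine squeeze_zero_norm (fun n => ?_) h3
      rw [norm_smul, norm_inv, Real.norm_eq_abs, abs_of_pos (hγ0 n)]
      exact mul_le_mul_of_nonneg_right (inv_anti₀ hγmin (hγ n)) (norm_nonneg _)
    have h4 := h1.sub (((happ i).tendsto b).comp hb)
    rw [zero_sub] at h4
    refine h4.congr fun n => ?_
    have h5 : t n i = proxOp (fun y => (γ n : EReal) * f i y)
      (x n i - γ n • blockGradient g L (x n) i) := rfl
    rw [← h5, Function.comp_apply, sub_right_comm, smul_sub _ (x n i - t n i),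
      inv_smul_smul₀ (hγ0 n).ne']
  -- The tangent inequalities at `x n` pass to the limit as before, since the sublevel sets of `φ`
  -- are closed and convex.
  · set φ : PiLp 2 H → ℝ := fun y => ∑ k, g k (∑ i, L k i (y i)) with hφ
    have hφc : Continuous φ := by
      simp only [hφ, ← rowMap_apply]
      exact continuous_finsetSum _ fun k _ => (hg_diff k).continuous.comp (rowMap L k).continuous
    have hφconv : ConvexOn ℝ Set.univ φ := by
      refine ⟨convex_univ, fun v _ v' _ s s' hs hs' hss => ?_⟩
      simp only [hφ, ← rowMap_apply, map_add, map_smul, smul_eq_mul, Finset.mul_sum,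
        ← Finset.sum_add_distrib]
      exact Finset.sum_le_sum fun k _ =>
        (hg_convex k).2 (Set.mem_univ _) (Set.mem_univ _) hs hs' hss
    have hlim : Tendsto (fun n => φ y - inner ℝ (blockGradient g L (x n)) (y - x n)) atTop
        (𝓝 (φ y - inner ℝ b (y - l))) := by
      simp only [inner_sub_right]
      exact ((hb.inner tendsto_const_nhds).sub (hx.tendsto_inner hC hb)).const_sub _
    have : φ l ≤ φ y - inner ℝ b (y - l) := by
      refine le_of_forall_gt_imp_ge_of_dense fun β hβ => ?_
      have hconv : Convex ℝ {v | φ v ≤ β} := by simpa using hφconv.convex_le β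
      refine hx.mem_of_isClosed_of_convex (isClosed_le hφc continuous_const) hconv ?_
      filter_upwards [hlim.eventually_lt_const hβ] with n hn
      have := add_inner_blockGradient_le (L := L) hg_convex hg_diff (x n) y
      change φ (x n) ≤ β
      linarith
    linarith

end BlockSplitting

/-! ### Weak sequential compactness and Opial's argument. -/

section WeakCompactness

/-- Bounded sequences in a separable Hilbert space have weakly convergent subsequences. -/
lemma exists_weaklyConvergesTo_subseq {E : Type*} [NormedAddCommGroup E] [InnerProductSpace ℝ E]
    [CompleteSpace E] [TopologicalSpace.SeparableSpace E] {u : ℕ → E} {C : ℝ}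
    (hC : ∀ n, ‖u n‖ ≤ C) :
    ∃ l : E, ∃ φ : ℕ → ℕ, StrictMono φ ∧ WeaklyConvergesTo (u ∘ φ) l := by
  let w : ℕ → WeakDual ℝ E := fun n =>
    StrongDual.toWeakDual (InnerProductSpace.toDual ℝ E (u n))
  have hw : ∀ n, w n ∈ WeakDual.toStrongDual ⁻¹' Metric.closedBall (0 : StrongDual ℝ E) C := by
    intro n
    simp [w, hC n]
  obtain ⟨a, _, φ, hφ, hlim⟩ := WeakDual.isSeqCompact_closedBall ℝ E 0 C hw
  refine ⟨(InnerProductSpace.toDual ℝ E).symm (WeakDual.toStrongDual a), φ, hφ, fun y => ?_⟩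
  rw [InnerProductSpace.toDual_symm_apply]
  have := ((WeakDual.eval_continuous y).tendsto a).comp hlim
  exact this

variable {m : ℕ} {H : Fin m → Type*}
  [∀ i, NormedAddCommGroup (H i)] [∀ i, InnerProductSpace ℝ (H i)] [∀ i, CompleteSpace (H i)]
  [∀ i, TopologicalSpace.SeparableSpace (H i)]

/-- Opial's lemma for a weighted norm. -/
lemma exists_weaklyConvergesTo_of_opial {w : Fin m → ℝ} (hw : ∀ i, 0 < w i)
    {F : Set (PiLp 2 H)} {x : ℕ → PiLp 2 H} {C : ℝ} (hC : ∀ n, ‖x n‖ ≤ C)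
    (hconv : ∀ z ∈ F, ∃ c, Tendsto (fun n => ∑ i, w i * ‖x n i - z i‖ ^ 2) atTop (𝓝 c))
    (hF : ∀ l, ∀ φ : ℕ → ℕ, StrictMono φ → WeaklyConvergesTo (x ∘ φ) l → l ∈ F) :
    ∃ l ∈ F, WeaklyConvergesTo x l := by
  have huniq : ∀ l l' : PiLp 2 H, ∀ φ ψ : ℕ → ℕ, StrictMono φ → StrictMono ψ →
      WeaklyConvergesTo (x ∘ φ) l → WeaklyConvergesTo (x ∘ ψ) l' → l = l' := by
    intro l l' φ ψ hφ hψ hl hl'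
    obtain ⟨c, hc⟩ := hconv l (hF l φ hφ hl)
    obtain ⟨c', hc'⟩ := hconv l' (hF l' ψ hψ hl')
    -- Pairing `x n` with `d` gives, up to a constant, half the difference of two convergent
    -- weighted squared distances. Hence both cluster points have the same pairing with `d`, and
    -- their weighted squared distance is zero.
    let d : PiLp 2 H := WithLp.toLp 2 fun i => w i • (l i - l' i)
    have hd : ∀ n, inner ℝ (x n) d = (∑ i, w i * ‖x n i - l' i‖ ^ 2
        - ∑ i, w i * ‖x n i - l i‖ ^ 2
        + ∑ i, w i * (‖l i‖ ^ 2 - ‖l' i‖ ^ 2)) / 2 := by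
      intro n
      rw [PiLp.inner_apply, eq_div_iff two_ne_zero, Finset.sum_mul, ← Finset.sum_sub_distrib,
        ← Finset.sum_add_distrib]
      refine Finset.sum_congr rfl fun i _ => ?_
      rw [norm_sub_sq_real, norm_sub_sq_real]
      simp only [d, inner_smul_right, inner_sub_right]
      ring
    have hlim := ((hc'.sub hc).add_const (∑ i, w i * (‖l i‖ ^ 2 - ‖l' i‖ ^ 2))).div_const 2
    simp only [← hd] at hlim
    have h1 := tendsto_nhds_unique (hl d) (hlim.comp hφ.tendsto_atTop)
    have h2 := tendsto_nhds_unique (hl' d) (hlim.comp hψ.tendsto_atTop)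
    have h3 : inner ℝ (l - l') d = 0 := by rw [inner_sub_left, h1, h2, sub_self]
    have h4 : ∑ i, w i * ‖l i - l' i‖ ^ 2 = 0 := by
      rw [← h3, PiLp.inner_apply]
      refine Finset.sum_congr rfl fun i _ => ?_
      simp only [d, PiLp.sub_apply, inner_smul_right, real_inner_self_eq_norm_sq]
    rw [Finset.sum_eq_zero_iff_of_nonneg fun i _ => by have := hw i; positivity] at h4
    ext i
    have := h4 i (Finset.mem_univ i)
    simpa [(hw i).ne', sub_eq_zero] using this
  obtain ⟨l, φ, hφ, hl⟩ := exists_weaklyConvergesTo_subseq hC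
  refine ⟨l, hF l φ hφ hl, fun y => tendsto_of_subseq_tendsto fun ns hns => ?_⟩
  obtain ⟨ψ, hψ, hmono⟩ := strictMono_subseq_of_tendsto_atTop hns
  obtain ⟨l', χ, hχ, hl'⟩ := exists_weaklyConvergesTo_subseq (u := x ∘ ns ∘ ψ) fun n => hC _
  refine ⟨ψ ∘ χ, ?_⟩
  have := huniq l l' φ (ns ∘ ψ ∘ χ) hφ (hmono.comp hχ) hl hl'
  rw [this]
  exact hl' y

end WeakCompactness

/-! ### Conditional inequalities in integrated form. -/

section ConditionalBounds

variable {Ω : Type*} {F m0 : MeasurableSpace Ω} {P : Measure Ω}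

/-- `Y` has a conditional expectation bounded by `Z` given `F`: the integral of `Y` over every event
of `F` is at most that of `Z`. -/
def CondLE (F : MeasurableSpace Ω) {m0 : MeasurableSpace Ω} (P : Measure Ω) (Y Z : Ω → ℝ≥0∞) : Prop :=
  ∀ A, MeasurableSet[F] A → ∫⁻ ω in A, Y ω ∂P ≤ ∫⁻ ω in A, Z ω ∂P

/-- The hypothesis compares the measures with densities `Y` and `Z` restricted to `F`, so it extends
from events of `F` to weights measurable for `F`. -/
lemma CondLE.lintegral_mul_le {Y Z : Ω → ℝ≥0∞} (hF : F ≤ m0) (hY : Measurable Y)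
    (hZ : Measurable Z) (h : CondLE F P Y Z) {w : Ω → ℝ≥0∞} (hw : Measurable[F] w) :
    ∫⁻ ω, Y ω * w ω ∂P ≤ ∫⁻ ω, Z ω * w ω ∂P := by
  have h1 : (P.withDensity Y).trim hF ≤ (P.withDensity Z).trim hF := by
    refine Measure.le_iff.2 fun A hA => ?_
    rw [trim_measurableSet_eq hF hA, trim_measurableSet_eq hF hA, withDensity_apply _ (hF A hA),
      withDensity_apply _ (hF A hA)]
    exact h A hA
  have hw' : Measurable w := hw.mono hF le_rfl
  have h2 := lintegral_mono' h1 (le_refl w)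
  rw [lintegral_trim hF hw, lintegral_trim hF hw,
    lintegral_withDensity_eq_lintegral_mul _ hY hw',
    lintegral_withDensity_eq_lintegral_mul _ hZ hw'] at h2
  exact h2

lemma CondLE.mul_right {Y Z : Ω → ℝ≥0∞} (hF : F ≤ m0) (hY : Measurable Y)
    (hZ : Measurable Z) (h : CondLE F P Y Z) {w : Ω → ℝ≥0∞} (hw : Measurable[F] w) :
    CondLE F P (fun ω => Y ω * w ω) (fun ω => Z ω * w ω) := by
  intro A hA
  have h1 := h.lintegral_mul_le hF hY hZ (hw.indicator hA)
  rw [← lintegral_indicator (hF A hA), ← lintegral_indicator (hF A hA)]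
  convert h1 using 3 with ω ω <;>
  · by_cases hω : ω ∈ A <;> simp [hω]

lemma CondLE.add {Y Z Y' Z' : Ω → ℝ≥0∞} (hY : Measurable Y) (hZ : Measurable Z)
    (h : CondLE F P Y Z) (h' : CondLE F P Y' Z') :
    CondLE F P (fun ω => Y ω + Y' ω) (fun ω => Z ω + Z' ω) := by
  intro A hA
  rw [lintegral_add_left hY, lintegral_add_left hZ]
  exact add_le_add (h A hA) (h' A hA)

lemma CondLE.const_mul {Y Z : Ω → ℝ≥0∞} (hY : Measurable Y) (hZ : Measurable Z)
    (h : CondLE F P Y Z) (c : ℝ≥0∞) : CondLE F P (fun ω => c * Y ω) (fun ω => c * Z ω) := by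
  intro A hA
  rw [lintegral_const_mul _ hY, lintegral_const_mul _ hZ]
  exact mul_le_mul_right (h A hA) c

lemma condLE_of_le {Y Z : Ω → ℝ≥0∞} (h : ∀ ω, Y ω ≤ Z ω) : CondLE F P Y Z :=
  fun _ _ => lintegral_mono h

lemma CondLE.trans {Y Z W : Ω → ℝ≥0∞} (h : CondLE F P Y Z) (h' : CondLE F P Z W) :
    CondLE F P Y W := fun A hA => (h A hA).trans (h' A hA)

lemma CondLE.congr_ae {Y Z W : Ω → ℝ≥0∞} (h : CondLE F P Y Z) (h' : Z =ᵐ[P] W) :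
    CondLE F P Y W := fun A hA => (h A hA).trans_eq (lintegral_congr_ae (ae_restrict_of_ae h'))

lemma condLE_condLExp [IsFiniteMeasure P] (hF : F ≤ m0) (Y : Ω → ℝ≥0∞) :
    CondLE F P Y (condLExp F P Y) := fun _ hA => (setLIntegral_condLExp hF P Y hA).ge

lemma ENNReal.two_mul_mul_le_add_sq (a b : ℝ≥0∞) : 2 * (a * b) ≤ a ^ 2 + b ^ 2 := by
  by_cases ha : a = ∞
  · simp [ha]
  by_cases hb : b = ∞
  · simp [hb]
  lift a to ℝ≥0 using ha
  lift b to ℝ≥0 using hb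
  have := two_mul_le_add_sq a b
  rw [mul_assoc] at this
  exact_mod_cast this

/-- The conditional Cauchy-Schwarz inequality: a bound on conditional second moments gives a bound
on conditional first moments. -/
lemma CondLE.of_sq [IsFiniteMeasure P] {Y s : Ω → ℝ≥0∞} (hF : F ≤ m0) (hY : Measurable Y)
    (hs : Measurable[F] s) (h : CondLE F P (fun ω => Y ω ^ 2) (fun ω => s ω ^ 2)) :
    CondLE F P Y s := by
  intro A hA
  have hs' : Measurable s := hs.mono hF le_rfl
  -- perturb `s` so that it does not vanish
  suffices hδ : ∀ δ : ℝ≥0, 0 < δ → ∫⁻ ω in A, Y ω ∂P ≤ ∫⁻ ω in A, (s ω + δ) ∂P by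
    refine ENNReal.le_of_forall_pos_le_add fun ε hε _ => ?_
    have hfin : P A ≠ ∞ := measure_ne_top P A
    have hε' : 0 < ε / ((P A).toNNReal + 1) := by positivity
    refine (hδ _ hε').trans ?_
    rw [lintegral_add_right _ measurable_const, setLIntegral_const]
    gcongr
    rw [← ENNReal.coe_toNNReal hfin]
    rw [ENNReal.toNNReal_coe]
    have : ε / ((P A).toNNReal + 1) * (P A).toNNReal ≤ ε := by
      rw [div_mul_eq_mul_div]
      refine div_le_of_le_mul₀ (by positivity) (by positivity) ?_
      gcongr
      simp
    exact_mod_cast this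
  intro δ hδ
  set S : Ω → ℝ≥0∞ := fun ω => s ω + δ with hS
  have hSm : Measurable[F] S := hs.add_const _
  have hSm' : Measurable S := hSm.mono hF le_rfl
  have hS0 : ∀ ω, S ω ≠ 0 := fun ω => by simp [hS, hδ.ne']
  set A1 := A ∩ {ω | S ω ≠ ∞} with hA1
  have hA1m : MeasurableSet[F] A1 :=
    hA.inter (hSm (measurableSet_singleton ∞).compl)
  have hYS : CondLE F P (fun ω => Y ω ^ 2) (fun ω => S ω ^ 2) :=
    h.trans (condLE_of_le fun ω => by simp only [hS]; gcongr; exact le_self_add)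
  have h1 := hYS.mul_right hF (hY.pow_const 2) (hSm'.pow_const 2) (w := fun ω => (S ω)⁻¹)
    hSm.inv A1 hA1m
  have h2 : ∫⁻ ω in A1, Y ω ∂P ≤ ∫⁻ ω in A1, S ω ∂P := by
    by_cases hinf : ∫⁻ ω in A1, S ω ∂P = ∞
    · rw [hinf]; exact le_top
    -- Young's inequality `2 Y ≤ Y² / S + S` linearizes the square root. The weight `S⁻¹` is
    -- measurable for `F`, so `h1` bounds the integral of the quotient by that of `S`.
    have h3 : ∫⁻ ω in A1, 2 * Y ω ∂P ≤ ∫⁻ ω in A1, (Y ω ^ 2 * (S ω)⁻¹ + S ω) ∂P := by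
      refine setLIntegral_mono' (hF _ hA1m) fun ω hω => ?_
      have hω' : S ω ≠ ∞ := hω.2
      have h4 := mul_le_mul_left (ENNReal.two_mul_mul_le_add_sq (Y ω) (S ω)) (S ω)⁻¹
      rw [add_mul] at h4
      convert h4 using 1
      · rw [mul_assoc, mul_assoc, ENNReal.mul_inv_cancel (hS0 ω) hω', mul_one]
      · rw [sq (S ω), mul_assoc, ENNReal.mul_inv_cancel (hS0 ω) hω', mul_one]
    have h5 : ∫⁻ ω in A1, S ω ^ 2 * (S ω)⁻¹ ∂P = ∫⁻ ω in A1, S ω ∂P := by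
      refine setLIntegral_congr_fun (hF _ hA1m) fun ω hω => ?_
      have hω' : S ω ≠ ∞ := hω.2
      rw [sq, mul_assoc, ENNReal.mul_inv_cancel (hS0 ω) hω', mul_one]
    rw [h5] at h1
    rw [lintegral_const_mul _ hY, lintegral_add_right _ hSm'] at h3
    have h6 : 2 * ∫⁻ ω in A1, Y ω ∂P ≤ 2 * ∫⁻ ω in A1, S ω ∂P :=
      h3.trans (by rw [two_mul]; gcongr)
    exact (ENNReal.mul_le_mul_iff_right two_ne_zero ENNReal.ofNat_ne_top).1 h6
  have hsplit : A = A1 ∪ (A ∩ {ω | S ω = ∞}) := by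
    ext ω
    by_cases hω : S ω = ∞ <;> simp [hA1, hω]
  have hA2 : MeasurableSet (A ∩ {ω | S ω = ∞}) :=
    (hF _ hA).inter (hSm' (measurableSet_singleton ∞))
  have hdisj : Disjoint A1 (A ∩ {ω | S ω = ∞}) := by
    rw [Set.disjoint_left]
    rintro ω hω hω'
    exact hω.2 hω'.2
  rw [hsplit, lintegral_union hA2 hdisj, lintegral_union hA2 hdisj]
  refine add_le_add h2 (setLIntegral_mono' hA2 fun ω hω => ?_)
  have : s ω + δ = ∞ := hω.2
  rw [this]
  exact le_top

end ConditionalBounds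

/-! ### Almost supermartingales. -/

section RobbinsSiegmund

variable {Ω : Type*} {m0 : MeasurableSpace Ω} {P : Measure Ω} [IsFiniteMeasure P]

/-- A nonnegative integrable-at-time-zero process with the supermartingale property converges. -/
lemma ae_tendsto_of_condLE {ℱ : Filtration ℕ m0} {U : ℕ → Ω → ℝ}
    (hm : ∀ n, Measurable[ℱ n] (U n)) (h0 : ∀ n ω, 0 ≤ U n ω)
    (hint : ∫⁻ ω, ENNReal.ofReal (U 0 ω) ∂P < ∞)
    (h : ∀ n, CondLE (ℱ n) P (fun ω => ENNReal.ofReal (U (n + 1) ω))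
      (fun ω => ENNReal.ofReal (U n ω))) :
    ∀ᵐ ω ∂P, ∃ c, Tendsto (fun n => U n ω) atTop (𝓝 c) := by
  have hm' : ∀ n, Measurable (U n) := fun n => (hm n).mono (ℱ.le n) le_rfl
  have hbd : ∀ n, ∫⁻ ω, ENNReal.ofReal (U n ω) ∂P ≤ ∫⁻ ω, ENNReal.ofReal (U 0 ω) ∂P := by
    intro n
    induction n with
    | zero => exact le_rfl
    | succ n ih =>
      have := h n Set.univ MeasurableSet.univ
      rw [setLIntegral_univ, setLIntegral_univ] at this
      exact this.trans ih
  have hint' : ∀ n, Integrable (U n) P := fun n => by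
    refine ⟨(hm' n).aestronglyMeasurable, ?_⟩
    rw [hasFiniteIntegral_iff_ofReal (ae_of_all _ (h0 n))]
    exact (hbd n).trans_lt hint
  have hsup : Supermartingale U ℱ P := by
    refine supermartingale_of_setIntegral_succ_le (fun n => (hm n).stronglyMeasurable) hint'
      fun n A hA => ?_
    have h1 := h n A hA
    rw [← ofReal_integral_eq_lintegral_ofReal (hint' _).restrict (ae_of_all _ (h0 _)),
      ← ofReal_integral_eq_lintegral_ofReal (hint' _).restrict (ae_of_all _ (h0 _))] at h1
    exact (ENNReal.ofReal_le_ofReal_iff (integral_nonneg (h0 n))).1 h1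
  have hL1 : ∀ n, eLpNorm ((-U) n) 1 P ≤ (∫⁻ ω, ENNReal.ofReal (U 0 ω) ∂P).toNNReal := by
    intro n
    rw [ENNReal.coe_toNNReal hint.ne, Pi.neg_apply, eLpNorm_neg, eLpNorm_one_eq_lintegral_enorm]
    refine le_trans (le_of_eq (lintegral_congr fun ω => ?_)) (hbd n)
    rw [Real.enorm_eq_ofReal (h0 n ω)]
  filter_upwards [hsup.neg.exists_ae_tendsto_of_bdd hL1] with ω ⟨c, hc⟩
  exact ⟨-c, by simpa using hc.neg⟩

/-- The Robbins-Siegmund theorem, in a form without integrability assumptions. -/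
lemma robbins_siegmund {ℱ : Filtration ℕ m0} {V θ η : ℕ → Ω → ℝ}
    (hV : ∀ n, Measurable[ℱ n] (V n)) (hθ : ∀ n, Measurable[ℱ n] (θ n))
    (hη : ∀ n, Measurable[ℱ n] (η n))
    (hV0 : ∀ n ω, 0 ≤ V n ω) (hθ0 : ∀ n ω, 0 ≤ θ n ω) (hη0 : ∀ n ω, 0 ≤ η n ω)
    (hθV : ∀ n ω, θ n ω ≤ V n ω)
    (h : ∀ n, CondLE (ℱ n) P (fun ω => ENNReal.ofReal (V (n + 1) ω))
      (fun ω => ENNReal.ofReal (V n ω - θ n ω + η n ω)))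
    (hsum : ∀ᵐ ω ∂P, Summable fun n => η n ω) :
    ∀ᵐ ω ∂P, (∃ c, Tendsto (fun n => V n ω) atTop (𝓝 c)) ∧ Summable fun n => θ n ω := by
  -- Localization: on `D N n`, adding the past decreases and the unspent budget `N - ∑ η` to `V n`
  -- gives a nonnegative process. Cut off outside the shrinking sets `D N n`, it is a
  -- supermartingale started below `2 * N`.
  let D : ℕ → ℕ → Set Ω := fun N n => {ω | V 0 ω ≤ N ∧ ∑ k ∈ Finset.range n, η k ω ≤ N}
  let Q : ℕ → ℕ → Ω → ℝ := fun N n ω =>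
    V n ω + ∑ k ∈ Finset.range n, θ k ω + (N - ∑ k ∈ Finset.range n, η k ω)
  let U : ℕ → ℕ → Ω → ℝ := fun N n => (D N n).indicator (Q N n)
  have hsm : ∀ (a : ℕ → Ω → ℝ), (∀ n, Measurable[ℱ n] (a n)) → ∀ n j, n ≤ j + 1 →
      Measurable[ℱ j] fun ω => ∑ k ∈ Finset.range n, a k ω := by
    intro a ha n j hj
    refine Finset.measurable_fun_sum _ fun k hk => (ha k).mono (ℱ.mono ?_) le_rfl
    have := Finset.mem_range.1 hk
    omega
  -- The sums stop at `n - 1`, so `D N (n + 1)` is already known at time `n` and the conditional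
  -- bound may be integrated over it.
  have hDm : ∀ N n j, n ≤ j + 1 → MeasurableSet[ℱ j] (D N n) := fun N n j hj =>
    (measurableSet_le ((hV 0).mono (ℱ.mono (Nat.zero_le j)) le_rfl) measurable_const).inter
      (measurableSet_le (hsm η hη n j hj) measurable_const)
  have hUm : ∀ N n, Measurable[ℱ n] (U N n) := fun N n => by
    refine Measurable.indicator ?_ (hDm N n n (Nat.le_succ n))
    exact ((hV n).add (hsm θ hθ n n (Nat.le_succ n))).add
      (measurable_const.sub (hsm η hη n n (Nat.le_succ n)))
  have hU0 : ∀ N n ω, 0 ≤ U N n ω := by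
    intro N n ω
    refine Set.indicator_nonneg (fun ω hω => ?_) ω
    have := Finset.sum_nonneg fun k (_ : k ∈ Finset.range n) => hθ0 k ω
    have h1 := hω.2
    have h2 := hV0 n ω
    simp only [Q]
    linarith
  have hconv : ∀ N, ∀ᵐ ω ∂P, ∃ c, Tendsto (fun n => U N n ω) atTop (𝓝 c) := by
    intro N
    refine ae_tendsto_of_condLE (hUm N) (hU0 N) ?_ fun n A hA => ?_
    · refine (lintegral_mono (g := fun _ => ENNReal.ofReal (2 * N)) fun ω => ?_).trans_lt ?_
      · refine ENNReal.ofReal_le_ofReal ?_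
        refine Set.indicator_apply_le' (fun hω => ?_) fun _ => by positivity
        have := hω.1
        simp only [Q, Finset.range_zero, Finset.sum_empty]
        linarith
      · rw [lintegral_const]
        exact ENNReal.mul_lt_top ENNReal.ofReal_lt_top (measure_lt_top P _)
    · have hAD := hA.inter (hDm N (n + 1) n le_rfl)
      have h1 := h n _ hAD
      set R : Ω → ℝ≥0∞ := fun ω => ENNReal.ofReal
        (∑ k ∈ Finset.range (n + 1), θ k ω + (N - ∑ k ∈ Finset.range (n + 1), η k ω)) with hR
      have hRm : Measurable R := ENNReal.measurable_ofReal.comp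
        (((hsm θ hθ (n + 1) n le_rfl).add
          (measurable_const.sub (hsm η hη (n + 1) n le_rfl))).mono (ℱ.le n) le_rfl)
      have hDmono : D N (n + 1) ⊆ D N n := fun ω hω => by
        refine ⟨hω.1, le_trans ?_ hω.2⟩
        rw [Finset.sum_range_succ]
        linarith [hη0 n ω]
      have hRnn : ∀ ω ∈ D N (n + 1), 0 ≤ ∑ k ∈ Finset.range (n + 1), θ k ω +
          (N - ∑ k ∈ Finset.range (n + 1), η k ω) := fun ω hω => by
        have := Finset.sum_nonneg fun k (_ : k ∈ Finset.range (n + 1)) => hθ0 k ω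
        linarith [hω.2]
      have hm1 : MeasurableSet (A ∩ D N (n + 1)) := ℱ.le n _ hAD
      calc ∫⁻ ω in A, ENNReal.ofReal (U N (n + 1) ω) ∂P
          = ∫⁻ ω in A ∩ D N (n + 1), ENNReal.ofReal (Q N (n + 1) ω) ∂P := by
            rw [Set.inter_comm, ← Measure.restrict_restrict (ℱ.le n _ (hDm N (n + 1) n le_rfl)),
              ← lintegral_indicator (ℱ.le n _ (hDm N (n + 1) n le_rfl))]
            refine lintegral_congr fun ω => ?_
            by_cases hω : ω ∈ D N (n + 1) <;> simp [U, hω]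
        _ = ∫⁻ ω in A ∩ D N (n + 1), (ENNReal.ofReal (V (n + 1) ω) + R ω) ∂P := by
            refine setLIntegral_congr_fun hm1 fun ω hω => ?_
            simp only [Q, hR]
            rw [add_assoc, ENNReal.ofReal_add (hV0 _ _) (hRnn ω hω.2)]
        _ ≤ ∫⁻ ω in A ∩ D N (n + 1), (ENNReal.ofReal (V n ω - θ n ω + η n ω) + R ω) ∂P := by
            rw [lintegral_add_right _ hRm, lintegral_add_right _ hRm]
            gcongr
        _ = ∫⁻ ω in A ∩ D N (n + 1), ENNReal.ofReal (U N n ω) ∂P := by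
            refine setLIntegral_congr_fun hm1 fun ω hω => ?_
            simp only [U, hR]
            rw [Set.indicator_of_mem (hDmono hω.2), ← ENNReal.ofReal_add
              (by linarith [hθV n ω, hη0 n ω]) (hRnn ω hω.2)]
            simp only [Q, Finset.sum_range_succ]
            congr 1
            ring
        _ ≤ ∫⁻ ω in A, ENNReal.ofReal (U N n ω) ∂P :=
            lintegral_mono_set Set.inter_subset_left
  filter_upwards [ae_all_iff.2 hconv, hsum] with ω hω hs
  -- For this `N` the realization is never cut off, so convergence of `U N` concerns the process
  -- itself.
  obtain ⟨N, hN⟩ := exists_nat_ge (max (V 0 ω) (∑' k, η k ω))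
  have hmem : ∀ n, ω ∈ D N n := fun n =>
    ⟨(le_max_left _ _).trans hN, ((hs.sum_le_tsum _ fun k _ => hη0 k ω).trans
      (le_max_right _ _)).trans hN⟩
  obtain ⟨c, hc⟩ := hω N
  have hlim : Tendsto (fun n => V n ω + ∑ k ∈ Finset.range n, θ k ω) atTop
      (𝓝 (c - (N - ∑' k, η k ω))) := by
    refine (hc.sub (hs.hasSum.tendsto_sum_nat.const_sub (N : ℝ))).congr fun n => ?_
    simp only [U, Q, Set.indicator_of_mem (hmem n)]
    ring
  obtain ⟨C, hC⟩ := hlim.bddAbove_range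
  have hθs : Summable fun n => θ n ω := by
    refine summable_of_sum_range_le (c := C) (fun n => hθ0 n ω) fun n => ?_
    have : V n ω + ∑ k ∈ Finset.range n, θ k ω ≤ C := hC ⟨n, rfl⟩
    linarith [hV0 n ω]
  refine ⟨⟨_, (hlim.sub hθs.hasSum.tendsto_sum_nat).congr fun n => ?_⟩, hθs⟩
  ring

end RobbinsSiegmund

/-! ### Measurability of weak limits. -/

section WeakMeasurability

/-- A weakly measurable function with values in a separable Hilbert space is measurable. -/
lemma measurable_of_forall_measurable_inner {Ω E : Type*} [MeasurableSpace Ω]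
    [NormedAddCommGroup E] [InnerProductSpace ℝ E] [CompleteSpace E]
    [TopologicalSpace.SeparableSpace E] [MeasurableSpace E] [BorelSpace E] {l : Ω → E}
    (h : ∀ y : E, Measurable fun ω => inner ℝ (l ω) y) : Measurable l := by
  have : SecondCountableTopology E := UniformSpace.secondCountable_of_separable E
  let d : ℕ → E := TopologicalSpace.denseSeq E
  -- The projections onto these finite-dimensional spaces are finite sums of weak coordinates, hence
  -- measurable, and they converge pointwise to the identity.
  let U : ℕ → Submodule ℝ E := fun n => Submodule.span ℝ (d '' Set.Iic n)
  have hfin : ∀ n, FiniteDimensional ℝ (U n) := fun n =>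
    FiniteDimensional.span_of_finite ℝ ((Set.finite_Iic n).image d)
  have hU : Monotone U := fun a b hab =>
    Submodule.span_mono (Set.image_mono (Set.Iic_subset_Iic.2 hab))
  have hdense : (⊤ : Submodule ℝ E) ≤ (⨆ n, U n).topologicalClosure := by
    intro x _
    have h1 : Set.range d ⊆ ((⨆ n, U n : Submodule ℝ E) : Set E) := by
      rintro _ ⟨n, rfl⟩
      exact (le_iSup U n) (Submodule.subset_span ⟨n, Set.mem_Iic.2 le_rfl, rfl⟩)
    exact closure_mono h1 ((TopologicalSpace.denseRange_denseSeq E).closure_range ▸ Set.mem_univ x)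
  refine measurable_of_tendsto_metrizable (f := fun n ω => (U n).starProjection (l ω)) (fun n => ?_)
    (tendsto_pi_nhds.2 fun ω => Submodule.starProjection_tendsto_self U hU (l ω) hdense)
  have hsum : (fun ω => (U n).starProjection (l ω)) = fun ω =>
      ∑ i, inner ℝ (l ω) (stdOrthonormalBasis ℝ (U n) i : E) •
        (stdOrthonormalBasis ℝ (U n) i : E) := by
    ext ω
    rw [(stdOrthonormalBasis ℝ (U n)).starProjection_eq_sum_rankOne]
    simp [real_inner_comm]
  rw [hsum]
  exact Finset.measurable_fun_sum _ fun i _ => (h _).smul_const _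

/-- The weak limit of an almost surely weakly convergent sequence can be chosen measurable, with
values in a prescribed set containing the limits. -/
lemma exists_measurable_weak_limit {Ω E : Type*} [MeasurableSpace Ω] {P : Measure Ω}
    [NormedAddCommGroup E] [InnerProductSpace ℝ E] [CompleteSpace E]
    [TopologicalSpace.SeparableSpace E] [MeasurableSpace E] [BorelSpace E] {x : ℕ → Ω → E}
    (hx : ∀ n, Measurable (x n)) {F : Set E} (hF : F.Nonempty)
    (h : ∀ᵐ ω ∂P, ∃ l ∈ F, WeaklyConvergesTo (fun n => x n ω) l) :
    ∃ xlim : Ω → E, Measurable xlim ∧ (∀ ω, xlim ω ∈ F) ∧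
      ∀ᵐ ω ∂P, WeaklyConvergesTo (fun n => x n ω) (xlim ω) := by
  classical
  have : SecondCountableTopology E := UniformSpace.secondCountable_of_separable E
  obtain ⟨z, hz⟩ := hF
  obtain ⟨S, hSae, hSm, hS⟩ := h.exists_measurable_mem
  choose! lim hlimF hlim using hS
  -- Taking the value `z` off the measurable full-measure set `S` keeps the limit in `F` everywhere.
  refine ⟨S.piecewise lim fun _ => z, measurable_of_forall_measurable_inner fun y => ?_,
    fun ω => ?_, ?_⟩
  · refine measurable_of_tendsto_metrizable
      (f := fun n ω => inner ℝ (S.piecewise (x n) (fun _ => z) ω) y) (fun n => ?_)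
      (tendsto_pi_nhds.2 fun ω => ?_)
    · exact (Measurable.piecewise hSm (hx n) measurable_const).inner measurable_const
    · by_cases hω : ω ∈ S
      · simpa [hω] using hlim ω hω y
      · simp [hω]
  · by_cases hω : ω ∈ S
    · simpa [hω] using hlimF ω hω
    · simpa [hω] using hz
  · filter_upwards [hSae] with ω hω
    simpa [hω] using hlim ω hω

end WeakMeasurability

/-! ### Averaging over an independent event. -/

section IndependentActivation

variable {Ω : Type*} {F C m0 : MeasurableSpace Ω} {P : Measure Ω}

lemma CondLE.finset_sum {ι : Type*} (s : Finset ι) {Y Z : ι → Ω → ℝ≥0∞}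
    (hY : ∀ i, Measurable (Y i)) (hZ : ∀ i, Measurable (Z i)) (h : ∀ i, CondLE F P (Y i) (Z i)) :
    CondLE F P (fun ω => ∑ i ∈ s, Y i ω) (fun ω => ∑ i ∈ s, Z i ω) := by
  intro A hA
  rw [lintegral_finsetSum _ fun i _ => hY i, lintegral_finsetSum _ fun i _ => hZ i]
  exact Finset.sum_le_sum fun i _ => h i A hA

/-- Conditional expectation of a function which switches on an event independent of `F`. -/
lemma condLE_piecewise_of_indep (hF : F ≤ m0) (hC : C ≤ m0)
    (hind : Indep C F P) {S : Set Ω} [DecidablePred (· ∈ S)] (hS : MeasurableSet[C] S)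
    {u v : Ω → ℝ≥0∞} (hu : Measurable[F] u) (hv : Measurable[F] v) :
    CondLE F P (S.piecewise u v) (fun ω => P S * u ω + P Sᶜ * v ω) := by
  have key : ∀ {T : Set Ω}, MeasurableSet[C] T → ∀ {w : Ω → ℝ≥0∞}, Measurable[F] w →
      ∀ A, MeasurableSet[F] A →
        ∫⁻ ω in A, w ω * T.indicator (fun _ => 1) ω ∂P = P T * ∫⁻ ω in A, w ω ∂P := by
    intro T hT w hw A hA
    have hI : IndepSets {s | MeasurableSet[F] s} {T} P := by
      rw [IndepSets_iff]
      rintro s t hs ht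
      rw [Set.mem_singleton_iff.1 ht, Set.inter_comm, mul_comm]
      exact (Indep_iff _ _ _).1 hind T s hT hs
    have h1 := lintegral_mul_indicator_eq_lintegral_mul_lintegral_indicator hF 1 (hC _ hT) hI
      (hw.indicator hA)
    rw [lintegral_indicator (hF A hA), lintegral_indicator (hC T hT), setLIntegral_const, one_mul,
      mul_comm] at h1
    rw [← h1, ← lintegral_indicator (hF A hA)]
    refine lintegral_congr fun ω => ?_
    by_cases hω : ω ∈ A <;> simp [hω]
  intro A hA
  have hu' : Measurable u := hu.mono hF le_rfl
  have hv' : Measurable v := hv.mono hF le_rfl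
  have hm : Measurable fun ω => u ω * S.indicator (fun _ => 1) ω :=
    hu'.mul (measurable_const.indicator (hC _ hS))
  rw [lintegral_add_left (hu'.const_mul _), lintegral_const_mul _ hu', lintegral_const_mul _ hv',
    ← key hS hu A hA, ← key hS.compl hv A hA, ← lintegral_add_left hm]
  refine lintegral_mono fun ω => ?_
  by_cases hω : ω ∈ S <;> simp [hω]

end IndependentActivation

/-! ### The weighted norm on the direct sum. -/

noncomputable section WeightedNorm

variable {m : ℕ} {H : Fin m → Type*}
  [∀ i, NormedAddCommGroup (H i)] [∀ i, InnerProductSpace ℝ (H i)]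

/-- The norm on the direct Hilbert sum in which the square of block `i` has weight `w i`. -/
def weightedNorm (w : Fin m → ℝ) (v : PiLp 2 H) : ℝ :=
  ‖(WithLp.toLp 2 fun i => Real.sqrt (w i) • v i : PiLp 2 H)‖

lemma weightedNorm_nonneg (w : Fin m → ℝ) (v : PiLp 2 H) : 0 ≤ weightedNorm w v := norm_nonneg _

lemma weightedNorm_sq {w : Fin m → ℝ} (hw : ∀ i, 0 ≤ w i) (v : PiLp 2 H) :
    weightedNorm w v ^ 2 = ∑ i, w i * ‖v i‖ ^ 2 := by
  rw [weightedNorm, PiLp.norm_sq_eq_of_L2]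
  refine Finset.sum_congr rfl fun i _ => ?_
  simp only
  rw [norm_smul, mul_pow, Real.norm_eq_abs, sq_abs, Real.sq_sqrt (hw i)]

lemma weightedNorm_add_le (w : Fin m → ℝ) (u v : PiLp 2 H) :
    weightedNorm w (u + v) ≤ weightedNorm w u + weightedNorm w v := by
  unfold weightedNorm
  refine le_trans (le_of_eq ?_) (norm_add_le _ _)
  congr 1
  ext i
  simp

lemma norm_le_weightedNorm {w : Fin m → ℝ} (hw : ∀ i, 1 ≤ w i) (v : PiLp 2 H) :
    ‖v‖ ≤ weightedNorm w v := by
  refine le_of_sq_le_sq ?_ (weightedNorm_nonneg _ _)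
  rw [weightedNorm_sq fun i => zero_le_one.trans (hw i), PiLp.norm_sq_eq_of_L2]
  exact Finset.sum_le_sum fun i _ => le_mul_of_one_le_left (sq_nonneg _) (hw i)

lemma weightedNorm_le {w : Fin m → ℝ} (hw : ∀ i, 0 ≤ w i) (v : PiLp 2 H) :
    weightedNorm w v ≤ Real.sqrt (∑ i, w i) * ‖v‖ := by
  refine le_of_sq_le_sq ?_ (by positivity)
  rw [weightedNorm_sq hw, mul_pow, Real.sq_sqrt (Finset.sum_nonneg fun i _ => hw i),
    Finset.sum_mul]
  refine Finset.sum_le_sum fun i _ => mul_le_mul_of_nonneg_left ?_ (hw i)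
  exact pow_le_pow_left₀ (norm_nonneg _) (PiLp.norm_apply_le v i) 2

lemma continuous_weightedNorm (w : Fin m → ℝ) : Continuous (weightedNorm (H := H) w) := by
  unfold weightedNorm
  refine continuous_norm.comp ((PiLp.continuous_toLp 2 H).comp ?_)
  fun_prop

end WeightedNorm

/-! ### One randomly activated step without errors. -/

section BlockIteration

variable {m : ℕ} {H : Fin m → Type*}
  [∀ i, NormedAddCommGroup (H i)] [∀ i, InnerProductSpace ℝ (H i)]

lemma norm_sq_relax_le {E : Type*} [NormedAddCommGroup E] [InnerProductSpace ℝ E] {c : ℝ}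
    (hc0 : 0 ≤ c) (hc1 : c ≤ 1) (u v : E) :
    ‖(1 - c) • u + c • v‖ ^ 2 ≤ (1 - c) * ‖u‖ ^ 2 + c * ‖v‖ ^ 2 := by
  have h1 : ‖u - v‖ ^ 2 = ‖u‖ ^ 2 - 2 * inner ℝ u v + ‖v‖ ^ 2 := norm_sub_sq_real u v
  rw [norm_add_sq_real, norm_smul, norm_smul, mul_pow, mul_pow, Real.norm_eq_abs, Real.norm_eq_abs,
    sq_abs, sq_abs, inner_smul_left, inner_smul_right]
  have h2 : 0 ≤ c * (1 - c) * ‖u - v‖ ^ 2 := by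
    have : 0 ≤ 1 - c := by linarith
    positivity
  simp only [RCLike.conj_to_real]
  nlinarith

variable {Ω : Type*} {F m0 : MeasurableSpace Ω} {P : Measure Ω} [IsProbabilityMeasure P]
  [∀ i, MeasurableSpace (H i)] [∀ i, BorelSpace (H i)] [∀ i, SecondCountableTopology (H i)]

/-- Conditional second moment of the weighted distance to `z` after an error-free randomly activated
relaxation step. -/
lemma condLE_sq_weightedNorm_step (hF : F ≤ m0) {ε : Ω → Fin m → ℝ} (hε : Measurable ε)
    (hε01 : ∀ ω i, ε ω i = 0 ∨ ε ω i = 1)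
    (hind : Indep (MeasurableSpace.comap ε inferInstance) F P) {w : Fin m → ℝ}
    (hw : ∀ i, 0 < w i) (hw1 : ∀ i, 1 ≤ w i) (hεw : ∀ i, P {ω | ε ω i = 1} = ENNReal.ofReal (w i)⁻¹)
    {c : ℝ} (hc0 : 0 ≤ c) (hc1 : c ≤ 1) {X T Y : Ω → PiLp 2 H} (hX : Measurable[F] X)
    (hT : Measurable[F] T) (hY : ∀ ω i, Y ω i = X ω i + (ε ω i * c) • (T ω i - X ω i))
    (z : PiLp 2 H) {θ : Ω → ℝ} (hθ : ∀ ω, ‖T ω - z‖ ^ 2 ≤ ‖X ω - z‖ ^ 2 - θ ω) :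
    CondLE F P (fun ω => ENNReal.ofReal (weightedNorm w (Y ω - z) ^ 2))
      (fun ω => ENNReal.ofReal (weightedNorm w (X ω - z) ^ 2 - c * θ ω)) := by
  classical
  have hw0 : ∀ i, 0 ≤ w i := fun i => (hw i).le
  set u : Fin m → Ω → ℝ := fun i ω => ‖(1 - c) • (X ω i - z i) + c • (T ω i - z i)‖ ^ 2
  set v : Fin m → Ω → ℝ := fun i ω => ‖X ω i - z i‖ ^ 2
  have happ : ∀ i : Fin m, Continuous fun v : PiLp 2 H => v i := fun i =>
    (PiLp.proj (𝕜 := ℝ) 2 H i).continuous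
  have hu : ∀ i, Measurable[F] (u i) := fun i => by
    have h1 : Measurable fun q : PiLp 2 H × PiLp 2 H => q.1 i :=
      (happ i).measurable.comp measurable_fst
    have h2 : Measurable fun q : PiLp 2 H × PiLp 2 H => q.2 i :=
      (happ i).measurable.comp measurable_snd
    have h3 : Measurable fun q : PiLp 2 H × PiLp 2 H =>
        ‖(1 - c) • (q.1 i - z i) + c • (q.2 i - z i)‖ ^ 2 :=
      (((h1.sub_const _).const_smul (1 - c)).add
        ((h2.sub_const _).const_smul c)).norm.pow_const 2
    exact h3.comp (hX.prodMk hT)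
  have hv : ∀ i, Measurable[F] (v i) := fun i =>
    (((happ i).measurable.sub_const (z i)).norm.pow_const 2).comp hX
  set S : Fin m → Set Ω := fun i => {ω | ε ω i = 1} with hSdef
  have hS : ∀ i, MeasurableSet[MeasurableSpace.comap ε inferInstance] (S i) := fun i =>
    ⟨{d | d i = 1}, (measurable_pi_apply i) (measurableSet_singleton 1), rfl⟩
  have hSc : ∀ i, P (S i)ᶜ = ENNReal.ofReal (1 - (w i)⁻¹) := fun i => by
    rw [prob_compl_eq_one_sub (hε.comap_le _ (hS i)), hεw i,
      ENNReal.ofReal_sub _ (inv_nonneg.2 (hw0 i)), ENNReal.ofReal_one]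
  have hY1 : ∀ ω i, ε ω i = 1 → ‖Y ω i - z i‖ ^ 2 = u i ω := fun ω i h => by
    simp only [u]
    rw [hY, h]
    congr 2
    module
  have hY0 : ∀ ω i, ε ω i = 0 → ‖Y ω i - z i‖ ^ 2 = v i ω := fun ω i h => by
    simp only [v]
    rw [hY, h, zero_mul, zero_smul, add_zero]
  -- Block `i` becomes `u i` with probability `(w i)⁻¹` and stays `v i` otherwise; multiplied by `w
  -- i`, the average is `u i + (w i - 1) * v i`. The coefficient of `u i` no longer depends on `i`.
  have hblock : ∀ i, CondLE F P
      ((S i).piecewise (fun ω => ENNReal.ofReal (w i * u i ω))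
        (fun ω => ENNReal.ofReal (w i * v i ω)))
      (fun ω => ENNReal.ofReal (u i ω + (w i - 1) * v i ω)) := by
    intro i
    refine (condLE_piecewise_of_indep hF hε.comap_le hind (hS i)
      (ENNReal.measurable_ofReal.comp ((hu i).const_mul (w i)))
      (ENNReal.measurable_ofReal.comp ((hv i).const_mul (w i)))).trans (condLE_of_le fun ω => ?_)
    have hu0 : 0 ≤ u i ω := sq_nonneg _
    have hv0 : 0 ≤ v i ω := sq_nonneg _
    have h1 : (w i)⁻¹ ≤ 1 := inv_le_one_of_one_le₀ (hw1 i)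
    have := hw0 i
    simp only [Function.comp_apply]
    rw [hSc, show P (S i) = _ from hεw i, ← ENNReal.ofReal_mul (inv_nonneg.2 (hw0 i)),
      ← ENNReal.ofReal_mul (by linarith), ← ENNReal.ofReal_add (by positivity)
        (mul_nonneg (by linarith) (by positivity))]
    refine le_of_eq ?_
    congr 1
    have := (hw i).ne'
    field_simp
  have hm1 : ∀ i, Measurable ((S i).piecewise (fun ω => ENNReal.ofReal (w i * u i ω))
        (fun ω => ENNReal.ofReal (w i * v i ω))) := fun i =>
    Measurable.piecewise (hε.comap_le _ (hS i))
      (ENNReal.measurable_ofReal.comp (((hu i).mono hF le_rfl).const_mul (w i)))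
      (ENNReal.measurable_ofReal.comp (((hv i).mono hF le_rfl).const_mul (w i)))
  have hm2 : ∀ i, Measurable fun ω => ENNReal.ofReal (u i ω + (w i - 1) * v i ω) := fun i =>
    ENNReal.measurable_ofReal.comp
      (((hu i).mono hF le_rfl).add (((hv i).mono hF le_rfl).const_mul _))
  refine (condLE_of_le fun ω => le_of_eq ?_).trans
    ((CondLE.finset_sum Finset.univ hm1 hm2 hblock).trans (condLE_of_le fun ω => ?_))
  · rw [weightedNorm_sq hw0, ENNReal.ofReal_sum_of_nonneg fun i _ => by
      have := hw0 i; positivity]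
    refine Finset.sum_congr rfl fun i _ => ?_
    rw [PiLp.sub_apply]
    rcases hε01 ω i with h | h
    · have hn : ω ∉ S i := fun h' => by
        rw [hSdef] at h'
        change ε ω i = 1 at h'
        rw [h] at h'
        exact zero_ne_one h'
      rw [hY0 ω i h, Set.piecewise_eq_of_notMem _ _ _ hn]
    · have hn : ω ∈ S i := h
      rw [hY1 ω i h, Set.piecewise_eq_of_mem _ _ _ hn]
  · rw [← ENNReal.ofReal_sum_of_nonneg fun i _ => add_nonneg (sq_nonneg _)
      (mul_nonneg (by linarith [hw1 i]) (sq_nonneg _))]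
    refine ENNReal.ofReal_le_ofReal ?_
    rw [weightedNorm_sq hw0]
    have h1 : ∑ i, u i ω = ‖(1 - c) • (X ω - z) + c • (T ω - z)‖ ^ 2 := by
      rw [PiLp.norm_sq_eq_of_L2]
      rfl
    have h2 : ∑ i, v i ω = ‖X ω - z‖ ^ 2 := by
      rw [PiLp.norm_sq_eq_of_L2]
      rfl
    have h3 := norm_sq_relax_le hc0 hc1 (X ω - z) (T ω - z)
    have h4 : ∑ i, (u i ω + (w i - 1) * v i ω)
        = ∑ i, u i ω + (∑ i, w i * ‖(X ω - z) i‖ ^ 2 - ∑ i, v i ω) := by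
      rw [← Finset.sum_sub_distrib, ← Finset.sum_add_distrib]
      refine Finset.sum_congr rfl fun i _ => ?_
      simp only [v, PiLp.sub_apply]
      ring
    rw [h4, h1, h2]
    nlinarith [mul_le_mul_of_nonneg_left (hθ ω) hc0]

end BlockIteration

/-! ### Stochastic quasi-Fejér monotonicity with errors. -/

section StochasticQuasiFejer

variable {m : ℕ} {H : Fin m → Type*}
  [∀ i, NormedAddCommGroup (H i)] [∀ i, InnerProductSpace ℝ (H i)]
  [∀ i, MeasurableSpace (H i)] [∀ i, BorelSpace (H i)] [∀ i, SecondCountableTopology (H i)]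
  {Ω : Type*} {m0 : MeasurableSpace Ω} {P : Measure Ω} [IsProbabilityMeasure P]

/-- Randomly activated relaxation steps with summable errors: the weighted distance to a common
quasi-fixed point `z` converges, and the decrease terms `θ` are summable. -/
lemma ae_tendsto_weightedNorm_and_summable {ℱ : Filtration ℕ m0} {ε : ℕ → Ω → Fin m → ℝ}
    (hε : ∀ n, Measurable (ε n)) (hε01 : ∀ n ω i, ε n ω i = 0 ∨ ε n ω i = 1)
    (hind : ∀ n, Indep (MeasurableSpace.comap (ε n) inferInstance) (ℱ n) P) {w : Fin m → ℝ}
    (hw1 : ∀ i, 1 ≤ w i)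
    (hεw : ∀ n i, P {ω | ε n ω i = 1} = ENNReal.ofReal (w i)⁻¹)
    {lam : ℕ → ℝ} (hlam0 : ∀ n, 0 ≤ lam n) (hlam1 : ∀ n, lam n ≤ 1) {X T Y : ℕ → Ω → PiLp 2 H}
    (hX : ∀ n, Measurable[ℱ n] (X n)) (hT : ∀ n, Measurable[ℱ n] (T n))
    (hYm : ∀ n, Measurable (Y n))
    (hY : ∀ n ω i, Y n ω i = X n ω i + (ε n ω i * lam n) • (T n ω i - X n ω i))
    {R ξ : ℕ → Ω → ℝ} (hXY : ∀ n ω, ‖X (n + 1) ω - Y n ω‖ ≤ R n ω)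
    (hRm : ∀ n, Measurable (R n)) (hξm : ∀ n, Measurable[ℱ n] (ξ n)) (hξ0 : ∀ n ω, 0 ≤ ξ n ω)
    (hRξ : ∀ n, CondLE (ℱ n) P (fun ω => ENNReal.ofReal (R n ω) ^ 2)
      (fun ω => ENNReal.ofReal (ξ n ω) ^ 2))
    (hξ : ∀ᵐ ω ∂P, Summable fun n => ξ n ω)
    (z : PiLp 2 H) {θ : ℕ → Ω → ℝ} (hθm : ∀ n, Measurable[ℱ n] (θ n)) (hθ0 : ∀ n ω, 0 ≤ θ n ω)
    (hθ : ∀ n ω, ‖T n ω - z‖ ^ 2 ≤ ‖X n ω - z‖ ^ 2 - θ n ω) :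
    ∀ᵐ ω ∂P, (∃ c, Tendsto (fun n => weightedNorm w (X n ω - z)) atTop (𝓝 c)) ∧
      Summable fun n => lam n * θ n ω := by
  have hw : ∀ i, 0 < w i := fun i => zero_lt_one.trans_le (hw1 i)
  have hw0 : ∀ i, 0 ≤ w i := fun i => (hw i).le
  set K := Real.sqrt (∑ i, w i) with hK
  have hK0 : 0 ≤ K := Real.sqrt_nonneg _
  have hR0 : ∀ n ω, 0 ≤ R n ω := fun n ω => (norm_nonneg _).trans (hXY n ω)
  set V : ℕ → Ω → ℝ := fun n ω => weightedNorm w (X n ω - z) with hV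
  set Z : ℕ → Ω → ℝ := fun n ω => weightedNorm w (Y n ω - z) with hZ
  have hV0 : ∀ n ω, 0 ≤ V n ω := fun n ω => weightedNorm_nonneg _ _
  have hZ0 : ∀ n ω, 0 ≤ Z n ω := fun n ω => weightedNorm_nonneg _ _
  have hN : Measurable fun v : PiLp 2 H => weightedNorm w (v - z) :=
    (continuous_weightedNorm w).measurable.comp (measurable_id.sub_const z)
  have hVm : ∀ n, Measurable[ℱ n] (V n) := fun n => hN.comp (hX n)
  have hVm' : ∀ n, Measurable (V n) := fun n => (hVm n).mono (ℱ.le n) le_rfl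
  have hξm' : ∀ n, Measurable (ξ n) := fun n => (hξm n).mono (ℱ.le n) le_rfl
  have hZm : ∀ n, Measurable (Z n) := fun n => hN.comp (hYm n)
  have hXV : ∀ n ω, ‖X n ω - z‖ ≤ V n ω := fun n ω => norm_le_weightedNorm hw1 _
  have hθX : ∀ n ω, θ n ω ≤ ‖X n ω - z‖ ^ 2 := fun n ω => by
    nlinarith [hθ n ω, sq_nonneg ‖T n ω - z‖]
  have hθV : ∀ n ω, lam n * θ n ω ≤ V n ω ^ 2 := fun n ω =>
    (mul_le_of_le_one_left (hθ0 n ω) (hlam1 n)).trans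
      ((hθX n ω).trans (pow_le_pow_left₀ (norm_nonneg _) (hXV n ω) 2))
  have hstep : ∀ n ω, V (n + 1) ω ≤ Z n ω + K * R n ω := by
    intro n ω
    have h1 : X (n + 1) ω - z = (Y n ω - z) + (X (n + 1) ω - Y n ω) := by abel
    simp only [hV, hZ]
    rw [h1]
    exact (weightedNorm_add_le _ _ _).trans (add_le_add_right ((weightedNorm_le hw0 _).trans
      (mul_le_mul_of_nonneg_left (hXY n ω) hK0)) _)
  -- A pointwise bound on `Z` by a quantity known at time `n`, so that the cross term `Z * R` needs
  -- only the conditional size of `R`. The three copies of `V` come from `‖T - z‖` and twice `‖X -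
  -- z‖`.
  have hZV : ∀ n ω, Z n ω ≤ 3 * K * V n ω := by
    intro n ω
    have h1 : ‖T n ω - z‖ ≤ ‖X n ω - z‖ := by
      refine le_of_sq_le_sq ?_ (norm_nonneg _)
      linarith [hθ n ω, hθ0 n ω]
    have h2 : ‖Y n ω - X n ω‖ ≤ ‖T n ω - X n ω‖ := by
      refine le_of_sq_le_sq ?_ (norm_nonneg _)
      rw [PiLp.norm_sq_eq_of_L2, PiLp.norm_sq_eq_of_L2]
      refine Finset.sum_le_sum fun i _ => pow_le_pow_left₀ (norm_nonneg _) ?_ 2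
      rw [PiLp.sub_apply, hY, add_sub_cancel_left, norm_smul, PiLp.sub_apply]
      refine mul_le_of_le_one_left (norm_nonneg _) ?_
      rw [Real.norm_eq_abs, abs_of_nonneg]
      · rcases hε01 n ω i with h | h <;> simp [h, hlam1 n]
      · rcases hε01 n ω i with h | h <;> simp [h, hlam0 n]
    have h3 : ‖T n ω - X n ω‖ ≤ ‖T n ω - z‖ + ‖X n ω - z‖ := by
      have : T n ω - X n ω = (T n ω - z) - (X n ω - z) := by abel
      rw [this]
      exact norm_sub_le _ _
    have h4 : ‖Y n ω - z‖ ≤ ‖Y n ω - X n ω‖ + ‖X n ω - z‖ := norm_sub_le_norm_sub_add_norm_sub _ _ _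
    have h5 : ‖Y n ω - z‖ ≤ 3 * V n ω := by linarith [hXV n ω]
    calc Z n ω ≤ K * ‖Y n ω - z‖ := weightedNorm_le hw0 _
      _ ≤ K * (3 * V n ω) := mul_le_mul_of_nonneg_left h5 hK0
      _ = _ := by ring
  have hsq : ∀ n, CondLE (ℱ n) P (fun ω => ENNReal.ofReal (Z n ω ^ 2))
      (fun ω => ENNReal.ofReal (V n ω ^ 2 - lam n * θ n ω)) := fun n =>
    condLE_sq_weightedNorm_step (ℱ.le n) (hε n) (hε01 n) (hind n) hw hw1 (hεw n) (hlam0 n)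
      (hlam1 n) (hX n) (hT n) (hY n) z (hθ n)
  have hof : ∀ {a : Ω → ℝ}, Measurable a → Measurable fun ω => ENNReal.ofReal (a ω) := fun h =>
    ENNReal.measurable_ofReal.comp h
  have hZ1 : ∀ n, CondLE (ℱ n) P (fun ω => ENNReal.ofReal (Z n ω))
      (fun ω => ENNReal.ofReal (V n ω)) := fun n => by
    refine CondLE.of_sq (ℱ.le n) (hof (hZm n)) (ENNReal.measurable_ofReal.comp (hVm n)) ?_
    simp only [← ENNReal.ofReal_pow (hZ0 _ _), ← ENNReal.ofReal_pow (hV0 _ _)]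
    exact (hsq n).trans (condLE_of_le fun ω => ENNReal.ofReal_le_ofReal
      (sub_le_self _ (mul_nonneg (hlam0 n) (hθ0 n ω))))
  have hR1 : ∀ n, CondLE (ℱ n) P (fun ω => ENNReal.ofReal (R n ω))
      (fun ω => ENNReal.ofReal (ξ n ω)) := fun n =>
    CondLE.of_sq (ℱ.le n) (hof (hRm n)) (ENNReal.measurable_ofReal.comp (hξm n)) (hRξ n)
  -- First pass, on the unsquared distance: the error `K * ξ` is summable outright, and the
  -- resulting boundedness of `V` is what the second pass requires.
  have hconv : ∀ᵐ ω ∂P, ∃ c, Tendsto (fun n => V n ω) atTop (𝓝 c) := by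
    have := robbins_siegmund (P := P) (ℱ := ℱ) (V := V) (θ := fun _ _ => 0)
      (η := fun n ω => K * ξ n ω) hVm (fun n => measurable_const) (fun n => (hξm n).const_mul K) hV0
      (fun _ _ => le_rfl) (fun n ω => mul_nonneg hK0 (hξ0 n ω)) (fun n ω => hV0 n ω) (fun n => ?_) ?_
    · exact this.mono fun ω hω => hω.1
    · refine (condLE_of_le fun ω => ?_).trans (((hZ1 n).add (hof (hZm n)) (hof (hVm' n))
        ((hR1 n).const_mul (hof (hRm n)) (hof (hξm' n)) (ENNReal.ofReal K))).trans
          (condLE_of_le fun ω => ?_))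
      · rw [← ENNReal.ofReal_mul hK0, ← ENNReal.ofReal_add (hZ0 _ _) (mul_nonneg hK0 (hR0 _ _))]
        exact ENNReal.ofReal_le_ofReal (hstep n ω)
      · rw [← ENNReal.ofReal_mul hK0, ← ENNReal.ofReal_add (hV0 _ _) (mul_nonneg hK0 (hξ0 _ _)),
          sub_zero]
    · exact hξ.mono fun ω hω => hω.mul_left K
  -- Second pass, on the square: `(Z + K * R) ^ 2` has cross term `2 * K * Z * R ≤ 6 * K ^ 2 * (R *
  -- V)`, whose conditional bound is summable because `V` is bounded along almost every realization.
  have hsum := robbins_siegmund (P := P) (ℱ := ℱ) (V := fun n ω => V n ω ^ 2)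
    (θ := fun n ω => lam n * θ n ω)
    (η := fun n ω => 6 * K ^ 2 * (ξ n ω * V n ω) + K ^ 2 * ξ n ω ^ 2)
    (fun n => (hVm n).pow_const 2) (fun n => (hθm n).const_mul _)
    (fun n => (((hξm n).mul (hVm n)).const_mul _).add (((hξm n).pow_const 2).const_mul _))
    (fun n ω => sq_nonneg _) (fun n ω => mul_nonneg (hlam0 n) (hθ0 n ω))
    (fun n ω => by have := hV0 n ω; have := hξ0 n ω; positivity) hθV (fun n => ?_) ?_
  · filter_upwards [hconv, hsum] with ω h1 h2
    exact ⟨h1, h2.2⟩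
  · have hK6 : 0 ≤ 6 * K ^ 2 := by positivity
    have hK2 : 0 ≤ K ^ 2 := by positivity
    have hA := (hR1 n).mul_right (ℱ.le n) (hof (hRm n)) (hof (hξm' n))
      (w := fun ω => ENNReal.ofReal (V n ω)) (ENNReal.measurable_ofReal.comp (hVm n))
    have hB := (hA.const_mul ((hof (hRm n)).mul (hof (hVm' n))) ((hof (hξm' n)).mul (hof (hVm' n)))
      (ENNReal.ofReal (6 * K ^ 2))).add
        (((hof (hRm n)).mul (hof (hVm' n))).const_mul _)
        (((hof (hξm' n)).mul (hof (hVm' n))).const_mul _)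
        ((hRξ n).const_mul ((hof (hRm n)).pow_const 2) ((hof (hξm' n)).pow_const 2)
        (ENNReal.ofReal (K ^ 2)))
    have hC := (hsq n).add (hof ((hZm n).pow_const 2))
      (hof (((hVm' n).pow_const 2).sub (((hθm n).mono (ℱ.le n) le_rfl).const_mul _))) hB
    refine (condLE_of_le fun ω => ?_).trans (hC.trans (condLE_of_le fun ω => le_of_eq ?_))
    · have h1 := hR0 n ω
      have h2 := hV0 n ω
      have h3 := hZ0 n ω
      simp only [Pi.mul_apply]
      rw [← ENNReal.ofReal_mul h1, ← ENNReal.ofReal_mul hK6, ← ENNReal.ofReal_pow h1,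
        ← ENNReal.ofReal_mul hK2, ← ENNReal.ofReal_add (by positivity) (by positivity),
        ← ENNReal.ofReal_add (by positivity) (by positivity)]
      refine ENNReal.ofReal_le_ofReal ?_
      have h4 := pow_le_pow_left₀ (hV0 (n + 1) ω) (hstep n ω) 2
      have h5 := mul_le_mul_of_nonneg_right (hZV n ω) (mul_nonneg hK0 h1)
      nlinarith
    · have h1 := hξ0 n ω
      have h2 := hV0 n ω
      have h3 : 0 ≤ V n ω ^ 2 - lam n * θ n ω := sub_nonneg.2 (hθV n ω)
      simp only [Pi.mul_apply, Pi.sub_apply]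
      rw [← ENNReal.ofReal_mul h1, ← ENNReal.ofReal_mul hK6, ← ENNReal.ofReal_pow h1,
        ← ENNReal.ofReal_mul hK2, ← ENNReal.ofReal_add (by positivity) (by positivity),
        ← ENNReal.ofReal_add h3 (by positivity)]
  · filter_upwards [hconv, hξ] with ω ⟨c, hc⟩ hs
    obtain ⟨M, hM⟩ := hc.bddAbove_range
    have hVM : ∀ n, V n ω ≤ M := fun n => hM ⟨n, rfl⟩
    refine Summable.add (Summable.mul_left _ ?_) (Summable.mul_left _ ?_)
    · exact Summable.of_nonneg_of_le (fun n => mul_nonneg (hξ0 n ω) (hV0 n ω))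
        (fun n => mul_le_mul_of_nonneg_left (hVM n) (hξ0 n ω)) (hs.mul_right M)
    · refine Summable.of_nonneg_of_le (fun n => sq_nonneg _) (fun n => ?_)
        (hs.mul_right (∑' k, ξ k ω))
      rw [sq]
      exact mul_le_mul_of_nonneg_left (hs.le_tsum n fun k _ => hξ0 k ω) (hξ0 n ω)

end StochasticQuasiFejer

/-! ### Convergence along a fixed realization. -/

section Convergence

lemma measurable_piLp {m : ℕ} {H : Fin m → Type*} {Ω : Type*} [MeasurableSpace Ω]
    [∀ i, MeasurableSpace (H i)] {u : Ω → PiLp 2 H} (h : ∀ i, Measurable fun ω => u ω i) : Measurable u :=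
  (WithLp.measurable_toLp 2 _).comp (measurable_pi_lambda _ h)

variable {m p : ℕ} {H : Fin m → Type*} {G : Fin p → Type*}
  [∀ i, NormedAddCommGroup (H i)]

lemma PiLp.norm_le_mul_norm_of_forall {u v : PiLp 2 H} {C : ℝ} (hC : 0 ≤ C)
    (h : ∀ i, ‖u i‖ ≤ C * ‖v i‖) : ‖u‖ ≤ C * ‖v‖ := by
  refine le_of_sq_le_sq ?_ (by positivity)
  rw [mul_pow, PiLp.norm_sq_eq_of_L2, PiLp.norm_sq_eq_of_L2, Finset.mul_sum]
  refine Finset.sum_le_sum fun i _ => ?_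
  rw [← mul_pow]
  exact pow_le_pow_left₀ (norm_nonneg _) (h i) 2

variable [∀ i, InnerProductSpace ℝ (H i)]

/-- The weighted distances to `x n` are Lipschitz in `z` with a constant independent of `n`, so the
Cauchy property passes to limits in `z`. A countable dense set of solutions therefore suffices. -/
lemma isClosed_setOf_tendsto_weightedNorm {w : Fin m → ℝ} (hw : ∀ i, 0 ≤ w i)
    (x : ℕ → PiLp 2 H) :
    IsClosed {z | ∃ c, Tendsto (fun n => weightedNorm w (x n - z)) atTop (𝓝 c)} := by
  refine isClosed_of_closure_subset fun z hz => cauchySeq_tendsto_of_complete ?_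
  set K := Real.sqrt (∑ i, w i)
  have hK : 0 ≤ K := Real.sqrt_nonneg _
  have hle : ∀ n (a b : PiLp 2 H),
      weightedNorm w (x n - a) ≤ weightedNorm w (x n - b) + K * ‖a - b‖ := by
    intro n a b
    have h1 : x n - a = (x n - b) + (b - a) := by abel
    rw [h1, norm_sub_rev a b]
    exact (weightedNorm_add_le _ _ _).trans (add_le_add_right (weightedNorm_le hw _) _)
  rw [Metric.cauchySeq_iff']
  intro δ hδ
  obtain ⟨z', ⟨c, hc⟩, hzz'⟩ := Metric.mem_closure_iff.1 hz (δ / (3 * (K + 1))) (by positivity)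
  have hKz : K * ‖z - z'‖ < δ / 3 := by
    rw [dist_eq_norm, lt_div_iff₀ (by positivity)] at hzz'
    nlinarith [norm_nonneg (z - z')]
  obtain ⟨N, hN⟩ := Metric.cauchySeq_iff'.1 hc.cauchySeq (δ / 3) (by positivity)
  refine ⟨N, fun n hn => ?_⟩
  have h1 := hN n hn
  rw [Real.dist_eq, abs_lt] at h1 ⊢
  have h2 := hle n z z'
  have h3 := hle n z' z
  have h4 := hle N z z'
  have h5 := hle N z' z
  rw [norm_sub_rev] at h3 h5
  constructor <;> linarith

variable [∀ i, CompleteSpace (H i)]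

lemma continuous_forwardBackward {f : ∀ i, H i → EReal} (hf : ∀ i, IsGammaZero (f i))
    {B : PiLp 2 H → PiLp 2 H} (hB : Continuous B) {γ : ℝ} (hγ : 0 < γ)
    (hne : ∀ i, ∃ z b, HasSubgradient (f i) z b) : Continuous (forwardBackward f B γ) := by
  refine (PiLp.continuous_toLp 2 H).comp (continuous_pi fun i => ?_)
  obtain ⟨z, b, hz⟩ := hne i
  have happ : Continuous fun v : PiLp 2 H => v i := (PiLp.proj (𝕜 := ℝ) 2 H i).continuous
  exact (lipschitzWith_proxOp (hf i) hγ hz).continuous.comp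
    (happ.sub ((happ.comp hB).const_smul γ))

/-- Summability of the decrease terms forces the residuals to vanish. -/
lemma tendsto_of_summable_decrease {E : Type*} [NormedAddCommGroup E] [NormedSpace ℝ E]
    {u v : ℕ → E} {γ lam κ : ℕ → ℝ} {l0 κ0 γ1 : ℝ} (hl0 : 0 < l0) (hl : ∀ n, l0 ≤ lam n)
    (hκ0 : 0 < κ0) (hκ : ∀ n, κ0 ≤ κ n) (hγ : ∀ n, |γ n| ≤ γ1)
    (h : Summable fun n => lam n * (κ n * ‖u n‖ ^ 2 + ‖v n - γ n • u n‖ ^ 2)) :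
    Tendsto u atTop (𝓝 0) ∧ Tendsto v atTop (𝓝 0) := by
  have hlim := h.tendsto_atTop_zero
  have hbd : ∀ n, l0 * (κ0 * ‖u n‖ ^ 2 + ‖v n - γ n • u n‖ ^ 2) ≤
      lam n * (κ n * ‖u n‖ ^ 2 + ‖v n - γ n • u n‖ ^ 2) := fun n => by
    have h1 := hκ n
    have h2 := hl n
    have h3 := hl0.le.trans h2
    gcongr
  have hsq : ∀ {y : ℕ → E}, Tendsto (fun n => ‖y n‖ ^ 2) atTop (𝓝 0) → Tendsto y atTop (𝓝 0) := by
    intro y hy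
    rw [tendsto_zero_iff_norm_tendsto_zero]
    have := hy.sqrt
    simpa using this
  have hu : Tendsto u atTop (𝓝 0) := by
    refine hsq (squeeze_zero (fun n => sq_nonneg _) (fun n => ?_)
      (by simpa using hlim.div_const (l0 * κ0)))
    rw [le_div_iff₀ (by positivity)]
    nlinarith [hbd n, mul_nonneg hl0.le (sq_nonneg ‖v n - γ n • u n‖)]
  have hvu : Tendsto (fun n => v n - γ n • u n) atTop (𝓝 0) := by
    refine hsq (squeeze_zero (fun n => sq_nonneg _) (fun n => ?_)
      (by simpa using hlim.div_const l0))
    rw [le_div_iff₀ hl0]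
    nlinarith [hbd n, mul_nonneg (mul_pos hl0 hκ0).le (sq_nonneg ‖u n‖)]
  refine ⟨hu, ?_⟩
  have hγu : Tendsto (fun n => γ n • u n) atTop (𝓝 0) := by
    refine squeeze_zero_norm (fun n => ?_) (by simpa using hu.norm.const_mul γ1)
    rw [norm_smul, Real.norm_eq_abs]
    exact mul_le_mul_of_nonneg_right (hγ n) (norm_nonneg _)
  simpa using hvu.add hγu

/-- The deterministic part of the convergence argument, along a given realization. -/
lemma exists_weaklyConvergesTo_mem_blockSolutions
    [∀ i, TopologicalSpace.SeparableSpace (H i)]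
    [∀ k, NormedAddCommGroup (G k)] [∀ k, InnerProductSpace ℝ (G k)] [∀ k, CompleteSpace (G k)]
    {f : ∀ i, H i → EReal} {g : ∀ k, G k → ℝ} {L : ∀ k i, H i →L[ℝ] G k}
    (hf : ∀ i, IsGammaZero (f i))
    (hg_convex : ∀ k, ConvexOn ℝ Set.univ (g k)) (hg_diff : ∀ k, Differentiable ℝ (g k))
    (hne : ∀ i, ∃ z b, HasSubgradient (f i) z b)
    {γ : ℕ → ℝ} {γ0 : ℝ} (hγ0 : 0 < γ0) (hγ : ∀ n, γ0 ≤ γ n)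
    {w : Fin m → ℝ} (hw : ∀ i, 1 ≤ w i) {x : ℕ → PiLp 2 H} {D : Set (PiLp 2 H)}
    (hD : blockSolutions f g L ⊆ closure D)
    (hconv : ∀ z ∈ D, ∃ c, Tendsto (fun n => weightedNorm w (x n - z)) atTop (𝓝 c))
    {b : PiLp 2 H} (hne' : (blockSolutions f g L).Nonempty)
    (hb : Tendsto (fun n => blockGradient g L (x n)) atTop (𝓝 b))
    (ht : Tendsto (fun n => x n - forwardBackward f (blockGradient g L) (γ n) (x n)) atTop (𝓝 0)) :
    ∃ l ∈ blockSolutions f g L, WeaklyConvergesTo x l := by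
  have hw0 : ∀ i, 0 ≤ w i := fun i => zero_le_one.trans (hw i)
  have hconv' : ∀ z ∈ blockSolutions f g L,
      ∃ c, Tendsto (fun n => weightedNorm w (x n - z)) atTop (𝓝 c) := fun z hz =>
    closure_minimal (fun z hz => hconv z hz) (isClosed_setOf_tendsto_weightedNorm hw0 x) (hD hz)
  obtain ⟨z, hz⟩ := hne'
  obtain ⟨c, hc⟩ := hconv' z hz
  obtain ⟨M, hM⟩ := hc.bddAbove_range
  have hbd : ∀ n, ‖x n‖ ≤ M + ‖z‖ := fun n => by
    have h1 : weightedNorm w (x n - z) ≤ M := hM ⟨n, rfl⟩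
    have h2 := norm_le_weightedNorm hw (x n - z)
    have h3 : x n = (x n - z) + z := by abel
    rw [h3]
    exact (norm_add_le _ _).trans (by linarith)
  refine exists_weaklyConvergesTo_of_opial (fun i => zero_lt_one.trans_le (hw i)) hbd
    (fun z hz => ?_) fun l φ hφ hl => ?_
  · obtain ⟨c, hc⟩ := hconv' z hz
    refine ⟨c ^ 2, (hc.pow 2).congr fun n => ?_⟩
    simp [weightedNorm_sq hw0]
  · exact mem_blockSolutions_of_weaklyConvergesTo hf hg_convex hg_diff hne (γ := γ ∘ φ) hγ0
      (fun n => hγ _) hl (fun n => hbd _) (hb.comp hφ.tendsto_atTop) (ht.comp hφ.tendsto_atTop)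

end Convergence

/-! ### Conditional size of the errors. -/

section ConditionalErrors

variable {Ω E : Type*} {F m0 : MeasurableSpace Ω} {P : Measure Ω} [IsFiniteMeasure P]
  [NormedAddCommGroup E] [MeasurableSpace E] [BorelSpace E]

lemma ENNReal.rpow_half_sq (q : ℝ≥0∞) : (q ^ (1 / 2 : ℝ)) ^ 2 = q := by
  rw [← ENNReal.rpow_natCast, ← ENNReal.rpow_mul]
  norm_num

lemma ENNReal.add_sq_le (a b : ℝ≥0∞) : (a + b) ^ 2 ≤ 2 * a ^ 2 + 2 * b ^ 2 := by
  calc (a + b) ^ 2 = 2 * (a * b) + (a ^ 2 + b ^ 2) := by ring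
    _ ≤ (a ^ 2 + b ^ 2) + (a ^ 2 + b ^ 2) := by gcongr; exact ENNReal.two_mul_mul_le_add_sq a b
    _ = _ := by ring

/-- The bound is a perfect square so that its root, linear in the conditional root mean squares,
inherits their summability; the factor 2 comes from `(s + t) ^ 2 ≤ 2 * s ^ 2 + 2 * t ^ 2`. -/
lemma condLE_sq_norm_add (hF : F ≤ m0) {a c : Ω → E} (ha : Measurable a) (hc : Measurable c)
    {κ : ℝ} (hκ : 0 ≤ κ) :
    CondLE F P (fun ω => ENNReal.ofReal (‖a ω‖ + κ * ‖c ω‖) ^ 2)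
      (fun ω => (2 * (condLExp F P (fun ω' => ‖a ω'‖ₑ ^ 2) ω ^ (1 / 2 : ℝ) + ENNReal.ofReal κ *
        condLExp F P (fun ω' => ‖c ω'‖ₑ ^ 2) ω ^ (1 / 2 : ℝ))) ^ 2) := by
  have hma : Measurable fun ω => ‖a ω‖ₑ ^ 2 := ha.enorm.pow_const 2
  have hmc : Measurable fun ω => ‖c ω‖ₑ ^ 2 := hc.enorm.pow_const 2
  have hqa := measurable_condLExp' F P fun ω' => ‖a ω'‖ₑ ^ 2
  have hqc := measurable_condLExp' F P fun ω' => ‖c ω'‖ₑ ^ 2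
  have h := ((condLE_condLExp (P := P) hF fun ω' => ‖a ω'‖ₑ ^ 2).const_mul hma hqa 2).add
    (hma.const_mul 2) (hqa.const_mul 2)
    ((condLE_condLExp (P := P) hF fun ω' => ‖c ω'‖ₑ ^ 2).const_mul hmc hqc
      (2 * ENNReal.ofReal κ ^ 2))
  refine (condLE_of_le fun ω => ?_).trans (h.trans (condLE_of_le fun ω => ?_))
  · rw [ENNReal.ofReal_add (norm_nonneg _) (by positivity), ENNReal.ofReal_mul hκ, ofReal_norm,
      ofReal_norm]
    refine (ENNReal.add_sq_le _ _).trans (le_of_eq ?_)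
    ring
  · set s := condLExp F P (fun ω' => ‖a ω'‖ₑ ^ 2) ω
    set t := condLExp F P (fun ω' => ‖c ω'‖ₑ ^ 2) ω
    conv_lhs => rw [← ENNReal.rpow_half_sq s, ← ENNReal.rpow_half_sq t]
    set s' := s ^ (1 / 2 : ℝ)
    set t' := ENNReal.ofReal κ * t ^ (1 / 2 : ℝ) with ht'
    calc 2 * s' ^ 2 + 2 * ENNReal.ofReal κ ^ 2 * (t ^ (1 / 2 : ℝ)) ^ 2
        = 2 * s' ^ 2 + 2 * t' ^ 2 := by rw [ht']; ring
      _ ≤ 2 * s' ^ 2 + 2 * t' ^ 2 + (2 * s' ^ 2 + 2 * t' ^ 2 + 8 * (s' * t')) := le_self_add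
      _ = (2 * (s' + t')) ^ 2 := by ring

end ConditionalErrors

/-! ### The convergence theorem. -/

theorem corollary5p10
    {m p : ℕ} {H : Fin m → Type*} {G : Fin p → Type*}
    [∀ i, NormedAddCommGroup (H i)] [∀ i, InnerProductSpace ℝ (H i)]
    [∀ i, CompleteSpace (H i)] [∀ i, TopologicalSpace.SeparableSpace (H i)]
    [∀ i, MeasurableSpace (H i)] [∀ i, BorelSpace (H i)]
    [∀ k, NormedAddCommGroup (G k)] [∀ k, InnerProductSpace ℝ (G k)]
    [∀ k, CompleteSpace (G k)] [∀ k, TopologicalSpace.SeparableSpace (G k)]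
    {Ω : Type*} [MeasurableSpace Ω] (P : Measure Ω) [IsProbabilityMeasure P]
    -- the minimization problem
    (f : ∀ i, H i → EReal) (hf : ∀ i, IsGammaZero (f i))
    (τ : Fin p → ℝ≥0) (hτ : ∀ k, 0 < τ k)
    (g : ∀ k, G k → ℝ) (hg_convex : ∀ k, ConvexOn ℝ Set.univ (g k))
    (hg_diff : ∀ k, Differentiable ℝ (g k))
    (hg_lip : ∀ k, LipschitzWith (τ k) (gradient (g k)))
    (L : ∀ k i, H i →L[ℝ] G k) (hL : ∀ k, 0 < ∑ i, ‖L k i‖ ^ 2)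
    (hF : (blockSolutions f g L).Nonempty)
    -- the parameters
    (ϑ : ℝ) (hϑ_pos : 0 < ϑ)
    (hϑ_le : ϑ ≤ (∑ k, (τ k : ℝ) *
      ‖∑ i, (L k i).comp (ContinuousLinearMap.adjoint (L k i))‖)⁻¹)
    (γ : ℕ → ℝ) (hγ_mem : ∀ n, γ n ∈ Set.Ioo 0 (2 * ϑ))
    (hγ_inf : 0 < (⨅ n, γ n)) (hγ_sup : (⨆ n, γ n) < 2 * ϑ)
    (lam : ℕ → ℝ) (hlam_mem : ∀ n, lam n ∈ Set.Ioc 0 1) (hlam_inf : 0 < (⨅ n, lam n))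
    -- the random variables and the iteration
    (x a c : ℕ → Ω → PiLp 2 H) (ε : ℕ → Ω → Fin m → ℝ)
    (hx0 : Measurable (x 0)) (ha : ∀ n, Measurable (a n)) (hc : ∀ n, Measurable (c n))
    (hε : ∀ n, Measurable (ε n)) (hε_mem : ∀ n ω, ε n ω ∈ activationSet m)
    (hε_ident : ∀ n, IdentDistrib (ε n) (ε 0) P P)
    (r : ∀ i, ℕ → Ω → H i)
    (hr : ∀ i n ω, r i n ω = ε n ω i • (x n ω i - γ n •
      ((∑ k, ContinuousLinearMap.adjoint (L k i)
        (gradient (g k) (∑ j, L k j (x n ω j)))) + c n ω i)))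
    (hx : ∀ i n ω, x (n + 1) ω i = x n ω i + (ε n ω i * lam n) •
      (proxOp (fun y => (γ n : EReal) * f i y) (r i n ω) + a n ω i - x n ω i))
    -- summability of the errors, independence, activation of every block
    (ha_sum : ∀ᵐ ω ∂P,
      (∑' n, (condLExp (pastSigma x n) P (fun ω' => ‖a n ω'‖ₑ ^ 2) ω) ^ (1 / 2 : ℝ)) < ∞)
    (hc_sum : ∀ᵐ ω ∂P,
      (∑' n, (condLExp (pastSigma x n) P (fun ω' => ‖c n ω'‖ₑ ^ 2) ω) ^ (1 / 2 : ℝ)) < ∞)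
    (h_indep : ∀ n, Indep (MeasurableSpace.comap (ε n) inferInstance) (pastSigma x n) P)
    (h_active : ∀ i, 0 < P {ω | ε 0 ω i = 1}) :
    ∃ xlim : Ω → PiLp 2 H, Measurable xlim ∧ (∀ ω, xlim ω ∈ blockSolutions f g L) ∧
      ∀ᵐ ω ∂P, WeaklyConvergesTo (fun n => x n ω) (xlim ω) := by

  have hsc : ∀ i, SecondCountableTopology (H i) := fun i =>
    UniformSpace.secondCountable_of_separable (H i)
  set B := blockGradient g L
  have hB : ∀ x y, ϑ * ‖B x - B y‖ ^ 2 ≤ inner ℝ (B x - B y) (x - y) :=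
    blockGradient_cocoercive hτ hg_convex hg_diff hg_lip hϑ_pos hϑ_le
  have hBc : Continuous B := continuous_blockGradient hg_lip
  have hsub : ∀ z ∈ blockSolutions f g L, ∀ i, HasSubgradient (f i) (z i) (-(B z i)) :=
    fun z hz i => hasSubgradient_of_mem_blockSolutions hf hg_diff hg_lip hz i
  obtain ⟨z0, hz0⟩ := id hF
  -- A solution supplies the subgradients on which the properties of the prox rest.
  have hne : ∀ i, ∃ z b, HasSubgradient (f i) z b := fun i => ⟨_, _, hsub z0 hz0 i⟩
  have hγ0 : ∀ n, 0 < γ n := fun n => (hγ_mem n).1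
  have hγinf : ∀ n, (⨅ n, γ n) ≤ γ n := fun n =>
    ciInf_le ⟨0, by rintro _ ⟨k, rfl⟩; exact (hγ0 k).le⟩ n
  have hγsup : ∀ n, γ n ≤ ⨆ n, γ n := fun n =>
    le_ciSup ⟨2 * ϑ, by rintro _ ⟨k, rfl⟩; exact (hγ_mem k).2.le⟩ n
  have hlaminf : ∀ n, (⨅ n, lam n) ≤ lam n := fun n =>
    ciInf_le ⟨0, by rintro _ ⟨k, rfl⟩; exact (hlam_mem k).1.le⟩ n
  have hε01 : ∀ n ω i, ε n ω i = 0 ∨ ε n ω i = 1 := fun n ω i => (hε_mem n ω).1 i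
  set T : ℕ → Ω → PiLp 2 H := fun n ω => forwardBackward f B (γ n) (x n ω) with hT
  have hTc : ∀ n, Continuous (forwardBackward f B (γ n)) := fun n =>
    continuous_forwardBackward hf hBc (hγ0 n) hne
  have happ : ∀ i : Fin m, Continuous fun v : PiLp 2 H => v i := fun i =>
    (PiLp.proj (𝕜 := ℝ) 2 H i).continuous
  have hεi : ∀ n i, Measurable fun ω => ε n ω i := fun n i => (measurable_pi_apply i).comp (hε n)
  have hr' : ∀ i n ω, r i n ω = ε n ω i • (x n ω i - γ n • (B (x n ω) i + c n ω i)) := hr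
  -- measurability of the iterates
  have hxm : ∀ n, Measurable (x n) := by
    intro n
    induction n with
    | zero => exact hx0
    | succ n ih =>
      refine measurable_piLp fun i => ?_
      obtain ⟨z, b, hz⟩ := hne i
      have hxi : Measurable fun ω => x n ω i := (happ i).measurable.comp ih
      have hBi : Measurable fun ω => B (x n ω) i := ((happ i).comp hBc).measurable.comp ih
      have hci : Measurable fun ω => c n ω i := (happ i).measurable.comp (hc n)
      have hai : Measurable fun ω => a n ω i := (happ i).measurable.comp (ha n)
      have hri : Measurable fun ω => r i n ω := by
        simp only [hr']
        exact (hεi n i).smul (hxi.sub ((hBi.add hci).const_smul (γ n)))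
      simp only [hx]
      exact hxi.add (((hεi n i).mul_const (lam n)).smul
        ((((lipschitzWith_proxOp (hf i) (hγ0 n) hz).continuous.measurable.comp hri).add hai).sub
          hxi))
  let ℱ : Filtration ℕ ‹MeasurableSpace Ω› :=
    { seq := pastSigma x
      mono' := fun n k hnk => biSup_mono fun j hj => by
        rw [Finset.mem_range] at hj ⊢
        omega
      le' := fun n => iSup₂_le fun j _ => (hxm j).comap_le }
  have hxF : ∀ n, Measurable[ℱ n] (x n) := fun n =>
    (comap_measurable (x n)).mono
      (le_iSup₂_of_le n (Finset.mem_range.2 n.lt_succ_self) le_rfl) le_rfl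
  -- the weights
  set w : Fin m → ℝ := fun i => (P {ω | ε 0 ω i = 1}).toReal⁻¹ with hw
  have hpw : ∀ i, 0 < (P {ω | ε 0 ω i = 1}).toReal := fun i =>
    ENNReal.toReal_pos (h_active i).ne' (measure_ne_top _ _)
  have hw1 : ∀ i, 1 ≤ w i := fun i => (one_le_inv₀ (hpw i)).2 measureReal_le_one
  have hεw : ∀ n i, P {ω | ε n ω i = 1} = ENNReal.ofReal (w i)⁻¹ := fun n i => by
    rw [hw, inv_inv, ENNReal.ofReal_toReal (measure_ne_top _ _)]
    exact (hε_ident n).measure_mem_eq (s := {d | d i = 1})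
      ((measurable_pi_apply i) (measurableSet_singleton 1))
  -- the error-free relaxation step
  set Y : ℕ → Ω → PiLp 2 H := fun n ω =>
    WithLp.toLp 2 fun i => x n ω i + (ε n ω i * lam n) • (T n ω i - x n ω i) with hY
  have hYm : ∀ n, Measurable (Y n) := fun n => measurable_piLp fun i => by
    have hxi : Measurable fun ω => x n ω i := (happ i).measurable.comp (hxm n)
    have hTi : Measurable fun ω => T n ω i :=
      ((happ i).comp (hTc n)).measurable.comp (hxm n)
    exact hxi.add (((hεi n i).mul_const (lam n)).smul (hTi.sub hxi))
  have hϑ2 : 0 ≤ 2 * ϑ := by positivity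
  have hXY : ∀ n ω, ‖x (n + 1) ω - Y n ω‖ ≤ ‖a n ω‖ + 2 * ϑ * ‖c n ω‖ := by
    intro n ω
    have hεl : ∀ i, |ε n ω i * lam n| ≤ 1 := fun i => by
      have := hlam_mem n
      rcases hε01 n ω i with h | h <;> simp [h, abs_of_pos this.1, this.2]
    let v : PiLp 2 H := WithLp.toLp 2 fun i => (ε n ω i * lam n) • a n ω i
    have hv : ‖v‖ ≤ 1 * ‖a n ω‖ := PiLp.norm_le_mul_norm_of_forall zero_le_one fun i => by
      simp only [v]
      rw [norm_smul, Real.norm_eq_abs]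
      exact mul_le_mul_of_nonneg_right (hεl i) (norm_nonneg _)
    have hd : ‖x (n + 1) ω - Y n ω - v‖ ≤ 2 * ϑ * ‖c n ω‖ := by
      refine PiLp.norm_le_mul_norm_of_forall hϑ2 fun i => ?_
      have h1 : (x (n + 1) ω - Y n ω - v) i = (ε n ω i * lam n) •
          (proxOp (fun y => (γ n : EReal) * f i y) (r i n ω) - T n ω i) := by
        simp only [PiLp.sub_apply, hx, hY, v]
        module
      rw [h1]
      -- On an inactive block the prox is evaluated at `r = 0`, but the vanishing step discards it.
      -- On an active one, nonexpansiveness bounds the effect of `c` by `γ n < 2 * ϑ` times its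
      -- norm.
      rcases hε01 n ω i with h | h
      · rw [h, zero_mul, zero_smul, norm_zero]
        positivity
      · obtain ⟨z, b, hz⟩ := hne i
        rw [norm_smul, Real.norm_eq_abs]
        refine (mul_le_of_le_one_left (norm_nonneg _) (hεl i)).trans ?_
        have h2 := (lipschitzWith_proxOp (hf i) (hγ0 n) hz).norm_sub_le (r i n ω)
          (x n ω i - γ n • B (x n ω) i)
        have h3 : r i n ω - (x n ω i - γ n • B (x n ω) i) = -(γ n • c n ω i) := by
          rw [hr', h]
          module
        rw [h3, norm_neg, norm_smul, Real.norm_eq_abs, abs_of_pos (hγ0 n), NNReal.coe_one,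
          one_mul] at h2
        exact h2.trans (mul_le_mul_of_nonneg_right (hγ_mem n).2.le (norm_nonneg _))
    have h4 : x (n + 1) ω - Y n ω = v + (x (n + 1) ω - Y n ω - v) := by abel
    rw [h4]
    exact (norm_add_le _ _).trans (add_le_add (by simpa using hv) hd)
  -- the conditional error bounds
  set ξE : ℕ → Ω → ℝ≥0∞ := fun n ω =>
    2 * (condLExp (pastSigma x n) P (fun ω' => ‖a n ω'‖ₑ ^ 2) ω ^ (1 / 2 : ℝ) +
      ENNReal.ofReal (2 * ϑ) *
        condLExp (pastSigma x n) P (fun ω' => ‖c n ω'‖ₑ ^ 2) ω ^ (1 / 2 : ℝ)) with hξE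
  have hξEm : ∀ n, Measurable[ℱ n] (ξE n) := fun n =>
    (((measurable_condLExp _ _ _).pow_const _).add
      (((measurable_condLExp _ _ _).pow_const _).const_mul _)).const_mul 2
  have hξsum : ∀ᵐ ω ∂P, ∑' n, ξE n ω ≠ ∞ := by
    filter_upwards [ha_sum, hc_sum] with ω h1 h2
    simp only [hξE]
    rw [ENNReal.tsum_mul_left, ENNReal.tsum_add, ENNReal.tsum_mul_left]
    exact ENNReal.mul_ne_top ENNReal.ofNat_ne_top
      (ENNReal.add_ne_top.2 ⟨h1.ne, ENNReal.mul_ne_top ENNReal.ofReal_ne_top h2.ne⟩)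
  have hRξ : ∀ n, CondLE (ℱ n) P (fun ω => ENNReal.ofReal (‖a n ω‖ + 2 * ϑ * ‖c n ω‖) ^ 2)
      (fun ω => ENNReal.ofReal (ξE n ω).toReal ^ 2) := fun n => by
    refine (condLE_sq_norm_add (ℱ.le n) (ha n) (hc n) hϑ2).congr_ae ?_
    filter_upwards [hξsum] with ω hω
    rw [ENNReal.ofReal_toReal (ENNReal.ne_top_of_tsum_ne_top hω n)]
  -- convergence of the weighted distances to a countable dense set of solutions
  set θ : PiLp 2 H → ℕ → Ω → ℝ := fun z n ω =>
    γ n * (2 * ϑ - γ n) * ‖B (x n ω) - B z‖ ^ 2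
      + ‖(x n ω - T n ω) - γ n • (B (x n ω) - B z)‖ ^ 2 with hθ
  have hquasi : ∀ z ∈ blockSolutions f g L, ∀ᵐ ω ∂P,
      (∃ l, Tendsto (fun n => weightedNorm w (x n ω - z)) atTop (𝓝 l)) ∧
        Summable fun n => lam n * θ z n ω := by
    intro z hz
    refine ae_tendsto_weightedNorm_and_summable (ℱ := ℱ) hε hε01 h_indep hw1 hεw
      (fun n => (hlam_mem n).1.le) (fun n => (hlam_mem n).2) hxF
      (fun n => (hTc n).measurable.comp (hxF n)) hYm (fun n ω i => rfl) hXY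
      (fun n => (ha n).norm.add ((hc n).norm.const_mul _)) (fun n => (hξEm n).ennreal_toReal)
      (fun n ω => ENNReal.toReal_nonneg) hRξ
      (hξsum.mono fun ω hω => ENNReal.summable_toReal hω) z (fun n => ?_) (fun n ω => ?_)
      fun n ω => ?_
    · have hcont : Continuous fun v => γ n * (2 * ϑ - γ n) * ‖B v - B z‖ ^ 2
          + ‖(v - forwardBackward f B (γ n) v) - γ n • (B v - B z)‖ ^ 2 := by
        have := hTc n
        fun_prop
      exact hcont.measurable.comp (hxF n)
    · have h1 := (hγ0 n).le
      have h2 : 0 ≤ 2 * ϑ - γ n := sub_nonneg.2 (hγ_mem n).2.le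
      positivity
    · have := sq_norm_forwardBackward_sub_le hf hB (hγ0 n) (hsub z hz) (x n ω)
      simp only [hθ, hT, Function.comp_apply]
      linarith
  -- The exceptional null set in `hquasi` depends on `z`; countability of `D` gives a common one.
  obtain ⟨D, hDF, hDc, hD⟩ := (TopologicalSpace.IsSeparable.of_separableSpace
    (blockSolutions f g L)).exists_countable_dense_subset
  refine exists_measurable_weak_limit hxm hF ?_
  filter_upwards [(ae_ball_iff hDc).2 fun z hz => hquasi z (hDF hz), hquasi z0 hz0] with ω h1 h2
  -- The single solution `z0` controls the residuals; `κ0` bounds `γ n * (2 * ϑ - γ n)` away from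
  -- zero.
  obtain ⟨hBz, hxt⟩ := tendsto_of_summable_decrease hlam_inf hlaminf
    (κ0 := (⨅ n, γ n) * (2 * ϑ - ⨆ n, γ n)) (mul_pos hγ_inf (sub_pos.2 hγ_sup))
    (fun n => mul_le_mul (hγinf n) (sub_le_sub_left (hγsup n) _) (sub_pos.2 hγ_sup).le (hγ0 n).le)
    (γ1 := 2 * ϑ) (fun n => by rw [abs_of_pos (hγ0 n)]; exact (hγ_mem n).2.le) h2.2
  exact exists_weaklyConvergesTo_mem_blockSolutions hf hg_convex hg_diff hne hγ_inf hγinf hw1 hD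
    (fun z hz => (h1 z hz).1) hF (b := B z0) (by simpa using hBz.add_const (B z0)) hxt
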